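/- Let $(\mathbb K,|\cdot|)$ be a field with an absolute value (archimedean or not, possibly trivial), $\operatorname{char}\mathbb K\neq 2$. Let $\mathbb K^c$ be its completion, $\overline{\mathbb K^c}$ an algebraic closure of $\mathbb K^c$ with the absolute value extending $|\cdot|$, $(\overline{\mathbb K^c})^c$ its completion, and $\overline{\mathbb K}\subseteq\overline{\mathbb K^c}$ the algebraic closure of $\mathbb K$. Fix $\sqrt{-1}\in\overline{\mathbb K}$. An element $\lambda\in\overline{\mathbb K}$ with minimal polynomial $X^d+a_{d-1}X^{d-1}+\dots+a_0$ over $\mathbb K$ is called $\mathbb K$-regular if $d$ is not a multiple of $\operatorname{char}\mathbb K$; then put $H_{\mathbb K}(\lambda)=-a_{d-1}/d\in\mathbb K$, $V_{\mathbb K}(\lambda)=\lambda-H_{\mathbb K}(\lambda)$ and $\overline\lambda=H_{\mathbb K}(\lambda)-V_{\mathbb K}(\lambda)$. Let $f(X)=\sum_{m\ge 0}a_mX^m\in\mathbb K[[X]]$ and let $R_f\in[0,+\infty]$ be the radius of convergence of the real series $\sum_m|a_m|X^m$. Let $\widehat\Omega_{f,\mathbb K}$ be the set of matrices $A\in M_n(\mathbb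 K)$ with spectral radius $<R_f$ all of whose eigenvalues $\lambda$ are $\mathbb K$-regular and satisfy, with $\alpha=H_{\mathbb K}(\lambda)$ and $\beta=V_{\mathbb K}(\lambda)$, $|\alpha|+|\beta|<R_f$ if $|\cdot|$ is archimedean and $\max(|\alpha|,|\beta|)<R_f$ if it is non-archimedean. For such $\lambda=\alpha+\beta$ put $$\mathcal Rf(\lambda)=\sum_{m\ge 0}a_m\sum_{h=0}^{\lfloor m/2\rfloor}\binom m{2h}\alpha^{m-2h}\beta^{2h},\qquad \mathcal If(\lambda)=-\sqrt{-1}\sum_{m\ge 1}a_m\sum_{h=1}^{\lfloor (m+1)/2\rfloor}\binom m{2h-1}\alpha^{m-2h+1}\beta^{2h-1}$$ in $(\overline{\mathbb K^c})^c$. Let $M\in\widehat\Omega_{f,\mathbb K}$ be nonzero and semisimple (diagonalizable over $\overline{\mathbb K}$), with every irreducible factor over $\mathbb K$ of its minimal polynomial of degree at most $2$ (splitting bound at most $2$). Let $\gamma_1,\dots,\gamma_s$ be the distinct nonzero eigenvalues of $M$ in $\mathbb K$, and let $\lambda_1,\overline\lambda_1,\dots,\lambda_t,\overline\lambda_t$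 be the distinct eigenvalues of $M$ not in $\mathbb K$. For an eigenvalue $\mu$ let $C_\mu(M)$ be the Frobenius covariant of $M$ at $\mu$, i.e. $C_\mu(M)=\prod_{\nu\ne\mu}(M-\nu I)/(\mu-\nu)$ over the eigenvalues $\nu\ne\mu$ of $M$. Put $$\mathcal A_i=C_{\gamma_i}(M),\quad \mathcal B_j=V_{\mathbb K}(\lambda_j)\,[C_{\lambda_j}(M)-\overline{C_{\lambda_j}(M)}],\quad \mathcal A_0=I_n-\sum_{i=1}^s\mathcal A_i-\sum_{j=1}^t\frac{\mathcal B_j^2}{V_{\mathbb K}(\lambda_j)^2},\quad \gamma_0=0,$$ where the bar denotes the entrywise map $\lambda\mapsto\overline\lambda$. Then these matrices lie in $M_n(\mathbb K)$ and give the fine Frobenius decomposition $$M=\sum_{i=0}^s\gamma_i\mathcal A_i+\sum_{j=1}^t\frac{H_{\mathbb K}(\lambda_j)}{V_{\mathbb K}(\lambda_j)^2}\mathcal B_j^2+\sum_{j=1}^t\mathcal B_j ,$$ that is, moreover, $s+t>0$, all $\mathcal A_i$ ($i\ge 1$) and $\mathcal B_j$ are nonzero, $\mathcal A_i\mathcal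 A_h=\delta_{ih}\mathcal A_i$ for $i,h\ge1$, $\mathcal A_i\mathcal B_j=\mathcal B_j\mathcal A_i=0$ for $i\ge1$, $\mathcal B_j\mathcal B_l=0$ for $j\neq l$, and $\mathcal B_j^3=V_{\mathbb K}(\lambda_j)^2\mathcal B_j$, where $V_{\mathbb K}(\lambda_j)^2\in\mathbb K$ is not a square in $\mathbb K$. Furthermore the series $f(M)=\sum_m a_mM^m$ (in $M_n(\mathbb K^c)$), $f(\gamma_i)$ (in $\mathbb K^c$), $\mathcal Rf(\lambda_j)$ and $\mathcal If(\lambda_j)$ converge, $$f(M)=\sum_{i=0}^s f(\gamma_i)\,\mathcal A_i+\sum_{j=1}^t\Big[\frac{\mathcal Rf(\lambda_j)}{V_{\mathbb K}(\lambda_j)^2}\,\mathcal B_j^2+\sqrt{-1}\,\frac{\mathcal If(\lambda_j)}{V_{\mathbb K}(\lambda_j)}\,\mathcal B_j\Big],$$ and $f(\gamma_i)$, $\mathcal Rf(\lambda_j)/V_{\mathbb K}(\lambda_j)^2$ and $\sqrt{-1}\,\mathcal If(\lambda_j)/V_{\mathbb K}(\lambda_j)$ belong to $\mathbb K^c$ for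 all $i,j$. -/

import Mathlib

/-! ### Extension of an absolute value of a complete field to an algebraic extension -/

theorem isAlgClosed_or_exists_ringHom_complex {F : Type*} [Field F] (g : AbsoluteValue F ℝ)
    (ι : ℝ →+* F) (hι : ∀ x, g (ι x) = |x|) :
    IsAlgClosed F ∨ ∃ φ : F →+* ℂ, ∀ x, ‖φ x‖ = g x := by
  let _ : NormedField F := g.toNormedField
  let _ : NormedAlgebra ℝ F :=
    { ι.toAlgebra with
      norm_smul_le := fun r x => by
        change g (ι r * x) ≤ |r| * g x
        rw [map_mul, hι] }
  rcases NormedAlgebra.Real.nonempty_algEquiv_or F with ⟨⟨e⟩⟩ | ⟨⟨e⟩⟩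
  · right
    refine ⟨Complex.ofRealHom.comp (e : F →+* ℝ), fun x => ?_⟩
    have hx : ι (e x) = x := by
      have := e.symm.commutes (e x)
      rw [Algebra.algebraMap_self_apply, e.symm_apply_apply] at this
      exact this.symm
    have := hι (e x)
    rw [hx] at this
    simpa using this.symm
  · left
    refine IsAlgClosed.of_exists_root F fun p _ hp => ?_
    obtain ⟨z, hz⟩ := IsAlgClosed.exists_root (p.map (e : F →+* ℂ)) (by
      rw [Polynomial.degree_map]
      exact (Polynomial.degree_pos_of_irreducible hp).ne')
    refine ⟨e.symm z, e.injective ?_⟩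
    have h := Polynomial.eval₂_at_apply (p := p) (e : F →+* ℂ) (e.symm z)
    have h' : (e : F →+* ℂ) (e.symm z) = z := e.apply_symm_apply z
    rw [h', ← Polynomial.eval_map] at h
    rw [map_zero]
    exact h.symm.trans hz

theorem exists_rpow_absoluteValue {F : Type*} [NormedField F] [CompleteSpace F]
    (h : ¬ ∀ n : ℕ, ‖(n : F)‖ ≤ 1) :
    ∃ (c : ℝ) (g : AbsoluteValue F ℝ) (ι : ℝ →+* F), 1 ≤ c ∧ (∀ x, g x = ‖x‖ ^ c) ∧
      ∀ x, g (ι x) = |x| := by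
  have hchar : CharZero F := by
    obtain ⟨p, hp⟩ := CharP.exists F
    rcases Nat.eq_zero_or_pos p with rfl | hpos
    · exact CharP.charP_to_charZero F
    exfalso
    push Not at h
    obtain ⟨n, hn⟩ := h
    have hb : ∀ k : ℕ, ‖(k : F)‖ ≤ p := fun k => by
      rw [CharP.cast_eq_mod F p k]
      refine (Nat.norm_cast_le _).trans ?_
      rw [norm_one, mul_one]
      exact_mod_cast (Nat.mod_lt k hpos).le
    obtain ⟨m, hm⟩ := pow_unbounded_of_one_lt (p : ℝ) hn
    have := hb (n ^ m)
    push_cast at this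
    rw [norm_pow] at this
    linarith
  let v : AbsoluteValue ℚ ℝ :=
    { toFun := fun q => ‖(q : F)‖
      map_mul' := fun x y => by simp
      nonneg' := fun x => norm_nonneg _
      eq_zero' := fun x => by simp
      add_le' := fun x y => by simpa using norm_add_le (x : F) (y : F) }
  have hv : ¬ ∀ n : ℕ, v n ≤ 1 := by simpa [v] using h
  obtain ⟨c, hc0, hc⟩ := AbsoluteValue.isEquiv_iff_exists_rpow_eq.1
    (Rat.AbsoluteValue.equiv_real_of_unbounded hv)
  have hc' : ∀ q : ℚ, ‖(q : F)‖ ^ c = |(q : ℝ)| := fun q => by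
    simpa [v] using congrFun hc q
  have hcinv : ∀ q : ℚ, ‖(q : F)‖ = |(q : ℝ)| ^ c⁻¹ := fun q => by
    rw [← hc' q, Real.rpow_rpow_inv (norm_nonneg _) hc0.ne']
  have hc1 : 1 ≤ c := by
    have h2 := hc' 2
    have h3 : ‖((2 : ℚ) : F)‖ ≤ 2 := by simpa using Nat.norm_cast_le (α := F) 2
    by_contra hlt
    push Not at hlt
    have h4 : ‖((2 : ℚ) : F)‖ ^ c ≤ (2 : ℝ) ^ c :=
      Real.rpow_le_rpow (norm_nonneg _) h3 hc0.le
    have h5 : (2 : ℝ) ^ c < 2 ^ (1 : ℝ) := Real.rpow_lt_rpow_of_exponent_lt (by norm_num) hlt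
    rw [Real.rpow_one] at h5
    rw [h2] at h4
    norm_num at h4
    linarith
  have key : ∀ x y : F, ‖x + y‖ ^ c ≤ ‖x‖ ^ c + ‖y‖ ^ c := by
    intro x y
    set a := ‖x‖ ^ c with ha
    set b := ‖y‖ ^ c with hb
    have ha0 : 0 ≤ a := by positivity
    have hb0 : 0 ≤ b := by positivity
    have hxa : ‖x‖ = a ^ c⁻¹ := (Real.rpow_rpow_inv (norm_nonneg _) hc0.ne').symm
    have hyb : ‖y‖ = b ^ c⁻¹ := (Real.rpow_rpow_inv (norm_nonneg _) hc0.ne').symm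
    have h1 : ∀ n : ℕ, (‖x + y‖ ^ c) ^ n ≤ (n + 1 : ℝ) ^ c * (a + b) ^ n := by
      intro n
      have h2 : ‖x + y‖ ^ n ≤ (n + 1) * ((a + b) ^ n) ^ c⁻¹ := by
        rw [← norm_pow, add_pow]
        refine (norm_sum_le _ _).trans ?_
        have : ∀ k ∈ Finset.range (n + 1),
            ‖x ^ k * y ^ (n - k) * (n.choose k : F)‖ ≤ ((a + b) ^ n) ^ c⁻¹ := by
          intro k hk
          have hn : ‖(n.choose k : F)‖ = (n.choose k : ℝ) ^ c⁻¹ := by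
            have := hcinv (n.choose k)
            simpa using this
          rw [norm_mul, norm_mul, norm_pow, norm_pow, hn, hxa, hyb, ← Real.rpow_natCast,
            ← Real.rpow_natCast, ← Real.rpow_mul ha0, ← Real.rpow_mul hb0, mul_comm c⁻¹,
            mul_comm c⁻¹, Real.rpow_mul ha0, Real.rpow_mul hb0, Real.rpow_natCast,
            Real.rpow_natCast, ← Real.mul_rpow (by positivity) (by positivity),
            ← Real.mul_rpow (by positivity) (by positivity)]
          refine Real.rpow_le_rpow (by positivity) ?_ (by positivity)
          rw [add_pow]
          exact Finset.single_le_sum (f := fun m => a ^ m * b ^ (n - m) * (n.choose m : ℝ))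
            (fun i _ => by positivity) hk
        refine (Finset.sum_le_sum this).trans ?_
        simp
      calc (‖x + y‖ ^ c) ^ n = (‖x + y‖ ^ n) ^ c := by
            rw [← Real.rpow_natCast, ← Real.rpow_natCast, ← Real.rpow_mul (norm_nonneg _),
              ← Real.rpow_mul (norm_nonneg _), mul_comm]
        _ ≤ ((n + 1) * ((a + b) ^ n) ^ c⁻¹) ^ c :=
            Real.rpow_le_rpow (by positivity) h2 hc0.le
        _ = (n + 1 : ℝ) ^ c * (a + b) ^ n := by
            rw [Real.mul_rpow (by positivity) (by positivity),
              Real.rpow_inv_rpow (by positivity) hc0.ne']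
    by_contra hlt
    push Not at hlt
    have hA : 0 < ‖x + y‖ ^ c := lt_of_le_of_lt (by positivity) hlt
    set A := ‖x + y‖ ^ c
    obtain ⟨N, hN⟩ := exists_nat_ge c
    have hr : |(a + b) / A| < 1 := by
      rw [abs_of_nonneg (by positivity)]
      exact (div_lt_one hA).2 hlt
    have ht := tendsto_pow_const_mul_const_pow_of_abs_lt_one N hr
    have ht2 : Filter.Tendsto (fun n : ℕ => 2 ^ N * ((n : ℝ) ^ N * ((a + b) / A) ^ n))
        Filter.atTop (nhds 0) := by simpa using ht.const_mul (2 ^ N)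
    obtain ⟨n, hn, hn1⟩ := ((ht2.eventually (gt_mem_nhds one_pos)).and
      (Filter.eventually_ge_atTop 1)).exists
    have h3 := h1 n
    have hn1' : (1 : ℝ) ≤ n := by exact_mod_cast hn1
    have h4 : (n + 1 : ℝ) ^ c ≤ (2 * n) ^ N := by
      calc (n + 1 : ℝ) ^ c ≤ (n + 1 : ℝ) ^ (N : ℝ) :=
            Real.rpow_le_rpow_of_exponent_le (by linarith) hN
        _ = (n + 1 : ℝ) ^ N := Real.rpow_natCast _ _
        _ ≤ (2 * n) ^ N := pow_le_pow_left₀ (by positivity) (by linarith) _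
    have h5 : 1 ≤ (n + 1 : ℝ) ^ c * ((a + b) / A) ^ n := by
      rw [div_pow, ← mul_div_assoc, le_div_iff₀ (by positivity), one_mul]
      exact h3
    have h6 : (n + 1 : ℝ) ^ c * ((a + b) / A) ^ n ≤ (2 * n) ^ N * ((a + b) / A) ^ n :=
      mul_le_mul_of_nonneg_right h4 (by positivity)
    rw [mul_pow] at h6
    rw [← mul_assoc] at hn
    linarith
  let g : AbsoluteValue F ℝ :=
    { toFun := fun x => ‖x‖ ^ c
      map_mul' := fun x y => by
        rw [norm_mul, Real.mul_rpow (norm_nonneg _) (norm_nonneg _)]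
      nonneg' := fun x => by positivity
      eq_zero' := fun x => by simp [Real.rpow_eq_zero (norm_nonneg _) hc0.ne']
      add_le' := key }
  have huc : UniformContinuous (Rat.castHom F) := by
    refine uniformContinuous_of_tendsto_zero (f := (Rat.castHom F)) ?_
    rw [tendsto_zero_iff_norm_tendsto_zero]
    have h1 : Filter.Tendsto (fun q : ℚ => |(q : ℝ)| ^ c⁻¹) (nhds 0) (nhds 0) := by
      have : Continuous (fun q : ℚ => |(q : ℝ)| ^ c⁻¹) :=
        (Real.continuous_rpow_const (by positivity)).comp
          (continuous_abs.comp Rat.continuous_coe_real)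
      have h0 := this.tendsto 0
      simpa [Real.zero_rpow (inv_ne_zero hc0.ne')] using h0
    refine h1.congr fun q => ?_
    simp [hcinv]
  have hui : IsUniformInducing (Rat.castHom ℝ) := Rat.isUniformEmbedding_coe_real.isUniformInducing
  have hd : DenseRange (Rat.castHom ℝ) := Rat.denseRange_cast
  let ι : ℝ →+* F := IsDenseInducing.extendRingHom hui hd huc
  have hcont : Continuous ι := (uniformContinuous_uniformly_extend hui hd huc).continuous
  refine ⟨c, g, ι, hc1, fun _ => rfl, fun x => ?_⟩
  change ‖ι x‖ ^ c = |x|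
  refine hd.induction_on (p := fun x => ‖ι x‖ ^ c = |x|) x ?_ fun q => ?_
  · exact isClosed_eq ((Real.continuous_rpow_const hc0.le).comp hcont.norm) continuous_abs
  · have : ι (Rat.castHom ℝ q) = Rat.castHom F q := map_ratCast ι q
    simp only [this]
    simpa using hc' q

theorem exists_absoluteValue_extending (F : Type*) [NormedField F] [CompleteSpace F]
    (L : Type*) [Field L] [Algebra F L] [Algebra.IsAlgebraic F L] :
    ∃ w : AbsoluteValue L ℝ, ∀ x : F, w (algebraMap F L x) = ‖x‖ := by
  classical
  by_cases h : ∀ n : ℕ, ‖(n : F)‖ ≤ 1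
  · have hu : IsUltrametricDist F :=
      IsUltrametricDist.isUltrametricDist_of_forall_norm_natCast_le_one h
    by_cases ht : ∃ x : F, x ≠ 0 ∧ ‖x‖ ≠ 1
    · let : NontriviallyNormedField F := NontriviallyNormedField.ofNormNeOne ht
      let : NormedField L := spectralNorm.normedField F L
      exact ⟨NormedField.toAbsoluteValue L, fun x => spectralNorm_extends (L := L) x⟩
    · push Not at ht
      refine ⟨AbsoluteValue.trivial, fun x => ?_⟩
      rcases eq_or_ne x 0 with rfl | hx
      · simp
      · rw [AbsoluteValue.trivial_apply (by simpa using hx), ht x hx]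
  · obtain ⟨c, g, ι, hc, hg, hι⟩ := exists_rpow_absoluteValue h
    have hc0 : 0 < c := by linarith
    rcases isAlgClosed_or_exists_ringHom_complex g ι hι with hF | ⟨φ, hφ⟩
    · have hb := IsAlgClosed.algebraMap_bijective_of_isIntegral (k := F) (K := L)
      let e : F ≃+* L := RingEquiv.ofBijective (algebraMap F L) hb
      refine ⟨(NormedField.toAbsoluteValue F).comp (f := (e.symm : L →+* F)) e.symm.injective, fun x => ?_⟩
      change ‖e.symm (e x)‖ = ‖x‖
      rw [e.symm_apply_apply]
    · let : Algebra F ℂ := φ.toAlgebra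
      let ψ : L →ₐ[F] ℂ := IsAlgClosed.lift
      refine ⟨{ toFun := fun x => ‖ψ x‖ ^ c⁻¹
                map_mul' := fun x y => by
                  rw [map_mul, norm_mul, Real.mul_rpow (norm_nonneg _) (norm_nonneg _)]
                nonneg' := fun x => by positivity
                eq_zero' := fun x => by
                  simp [Real.rpow_eq_zero (norm_nonneg _) (inv_ne_zero hc0.ne')]
                add_le' := fun x y => by
                  rw [map_add]
                  refine (Real.rpow_le_rpow (norm_nonneg _) (norm_add_le _ _)
                    (by positivity)).trans ?_
                  exact Real.rpow_add_le_add_rpow (norm_nonneg _) (norm_nonneg _) (by positivity)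
                    (inv_le_one_of_one_le₀ hc) }, fun x => ?_⟩
      change ‖ψ (algebraMap F L x)‖ ^ c⁻¹ = ‖x‖
      rw [ψ.commutes]
      change ‖φ x‖ ^ c⁻¹ = ‖x‖
      rw [hφ, hg, Real.rpow_rpow_inv (norm_nonneg _) hc0.ne']

/-! ### The completion, its algebraic closure, and the completion of the latter -/

section Fields

/-- The completion `K^c` of the valued field `K`. -/
abbrev Kc (K : Type*) [NormedField K] : Type _ := UniformSpace.Completion K

/-- A fixed algebraic closure of the completion `K^c`. It contains an algebraic closure of `K`,
namely the set of its elements that are algebraic over `K`. -/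
abbrev KcBar (K : Type*) [NormedField K] : Type _ := AlgebraicClosure (Kc K)

/-- The (unique) absolute value of the algebraic closure of `K^c` that extends that of `K^c`. -/
noncomputable def extendedAbs (K : Type*) [NormedField K] : AbsoluteValue (KcBar K) ℝ :=
  (exists_absoluteValue_extending (Kc K) (KcBar K)).choose

theorem extendedAbs_algebraMap (K : Type*) [NormedField K] (x : Kc K) :
    extendedAbs K (algebraMap (Kc K) (KcBar K) x) = ‖x‖ :=
  (exists_absoluteValue_extending (Kc K) (KcBar K)).choose_spec x

noncomputable instance instNormedFieldKcBar (K : Type*) [NormedField K] :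
    NormedField (KcBar K) :=
  (extendedAbs K).toNormedField

noncomputable instance instNormedAlgebraKcBar (K : Type*) [NormedField K] :
    NormedAlgebra (Kc K) (KcBar K) where
  norm_smul_le r x := by
    rw [Algebra.smul_def, norm_mul]
    exact le_of_eq (congrArg (· * ‖x‖) (extendedAbs_algebraMap K r))

noncomputable instance instNormedAlgebraBaseKcBar (K : Type*) [NormedField K] :
    NormedAlgebra K (KcBar K) where
  norm_smul_le r x := by
    rw [Algebra.smul_def, IsScalarTower.algebraMap_apply K (Kc K) (KcBar K), norm_mul,
      norm_algebraMap', UniformSpace.Completion.algebraMap_def, Algebra.algebraMap_self_apply,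
      UniformSpace.Completion.norm_coe]

/-- The completion of the algebraic closure of `K^c`. -/
abbrev KcBarC (K : Type*) [NormedField K] : Type _ := UniformSpace.Completion (KcBar K)

end Fields

/-! ### Regular elements and their decomposition -/

section Regular

variable (K : Type*) [Field K] {L : Type*} [Field L] [Algebra K L]

/-- The `K`-regular elements: the algebraic ones whose degree over `K` is not a multiple of the
characteristic of `K`. -/
def regularElements : Set L :=
  {x | IsAlgebraic K x ∧ ¬ ringChar K ∣ (minpoly K x).natDegree}

/-- The `K`-horizontal component `H_K(x) = - a_{d-1} / d` of a `K`-regular element `x` with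
minimal polynomial `X^d + a_{d-1} X^{d-1} + ... + a_0`. -/
noncomputable def horizontal (x : L) : K :=
  -(minpoly K x).coeff ((minpoly K x).natDegree - 1) / ((minpoly K x).natDegree : K)

/-- The `K`-vertical component `V_K(x) = x - H_K(x)`. -/
noncomputable def vertical (x : L) : L := x - algebraMap K L (horizontal K x)

/-- The `K`-involution `H_K(x) + V_K(x) ↦ H_K(x) - V_K(x)`. -/
noncomputable def involution (x : L) : L := algebraMap K L (horizontal K x) - vertical K x

end Regular

/-! ### Matrices: semisimplicity, splitting bound, fine Frobenius decomposition -/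

section Matrices

variable {K : Type*} [Field K] {n : ℕ}

/-- `M` is similar to a diagonal matrix over an algebraic closure of `K`. -/
def IsSemisimpleMatrix (M : Matrix (Fin n) (Fin n) K) : Prop :=
  ∃ (P : (Matrix (Fin n) (Fin n) (AlgebraicClosure K))ˣ) (d : Fin n → AlgebraicClosure K),
    M.map (algebraMap K (AlgebraicClosure K)) = P * Matrix.diagonal d * (P⁻¹ :)

/-- The maximal degree of an irreducible factor of `p` in `L[X]`. -/
noncomputable def Polynomial.splittingBound (L : Type*) [Field L] [Algebra K L]
    (p : Polynomial K) : ℕ∞ :=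
  ⨆ q ∈ {q : Polynomial L | Irreducible q ∧ q ∣ p.map (algebraMap K L)}, (q.natDegree : ℕ∞)

/-- The splitting bound over `L` of a matrix over `K`. -/
noncomputable def Matrix.splittingBound (L : Type*) [Field L] [Algebra K L]
    (M : Matrix (Fin n) (Fin n) K) : ℕ∞ :=
  (minpoly K M).splittingBound L

open Classical in
/-- The Frobenius covariant of a diagonalizable matrix `N` at its eigenvalue `μ`:
the product of the `(N - ν) / (μ - ν)` over all eigenvalues `ν ≠ μ`, i.e. the projection onto the
eigenspace of `μ` along the sum of the other eigenspaces. -/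
noncomputable def frobeniusCovariant {L : Type*} [Field L] (N : Matrix (Fin n) (Fin n) L) (μ : L) :
    Matrix (Fin n) (Fin n) L :=
  Polynomial.aeval N (Lagrange.basis N.finite_spectrum.toFinset id μ)

/-- The data `γ, A, α, ν, B` form a fine Frobenius decomposition
`M = ∑ γ i • A i - ∑ (α j / ν j) • B j ^ 2 + ∑ B j`. -/
structure IsFineFrobeniusDecomposition (M : Matrix (Fin n) (Fin n) K) {s t : ℕ}
    (γ : Fin s → K) (A : Fin s → Matrix (Fin n) (Fin n) K)
    (α ν : Fin t → K) (B : Fin t → Matrix (Fin n) (Fin n) K) : Prop where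
  eq_sum : M = ∑ i, γ i • A i - ∑ j, (α j / ν j) • B j ^ 2 + ∑ j, B j
  nonempty : 0 < s + t
  A_ne_zero : ∀ i, A i ≠ 0
  B_ne_zero : ∀ j, B j ≠ 0
  neg_not_square : ∀ j, ¬ IsSquare (-ν j)
  γ_ne_zero : ∀ i, γ i ≠ 0
  γ_injective : Function.Injective γ
  root_ne : ∀ j l, j ≠ l → ∀ x y : AlgebraicClosure K,
    x ^ 2 = -algebraMap K (AlgebraicClosure K) (ν j) →
    y ^ 2 = -algebraMap K (AlgebraicClosure K) (ν l) →
    algebraMap K (AlgebraicClosure K) (α j) + x ≠ algebraMap K (AlgebraicClosure K) (α l) + y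
  A_mul_self : ∀ i, A i * A i = A i
  A_mul_A : ∀ i h, i ≠ h → A i * A h = 0
  A_mul_B : ∀ i j, A i * B j = 0
  B_mul_A : ∀ i j, B j * A i = 0
  B_mul_B : ∀ j l, j ≠ l → B j * B l = 0
  B_cube : ∀ j, B j ^ 3 = -(ν j • B j)

/-- The elements `γ i` are the distinct nonzero eigenvalues of `M` in `K`, without repetition, and
the elements `lam j` together with their involutions are the distinct eigenvalues of `M`
in `L` that are not in `K`, without repetition. -/
structure IsEigenvalueListing {L : Type*} [Field L] [Algebra K L]
    (M : Matrix (Fin n) (Fin n) K) {s t : ℕ} (γ : Fin s → K) (lam : Fin t → L) : Prop where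
  γ_injective : Function.Injective γ
  range_γ : Set.range γ =
    {x | x ≠ 0 ∧ algebraMap K L x ∈ spectrum L (M.map (algebraMap K L))}
  lam_injective : Function.Injective (Sum.elim lam (fun j => involution K (lam j)))
  range_lam : Set.range (Sum.elim lam (fun j => involution K (lam j))) =
    {x | x ∉ Set.range (algebraMap K L) ∧ x ∈ spectrum L (M.map (algebraMap K L))}

end Matrices

/-! ### Power series over a valued field -/

section Series

variable {K : Type*} [NormedField K]

/-- The radius of convergence `R_f` of the real series `∑ |a_m| X^m`. -/
noncomputable def convRadius (f : PowerSeries K) : ENNReal :=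
  (FormalMultilinearSeries.ofScalars ℝ (fun m => ‖PowerSeries.coeff m f‖)).radius

/-- The sum `f(x) = ∑ a_m x^m` of the series in a topological `K`-algebra. -/
noncomputable def seriesValue {E : Type*} [Ring E] [Algebra K E] [TopologicalSpace E]
    (f : PowerSeries K) (x : E) : E :=
  ∑' m : ℕ, PowerSeries.coeff m f • x ^ m

/-- The matrices whose spectral radius is less than `R_f`. -/
def Omega (n : ℕ) (f : PowerSeries K) : Set (Matrix (Fin n) (Fin n) K) :=
  {A | spectralRadius (KcBar K) (A.map (algebraMap K (KcBar K))) < convRadius f}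

/-- The matrices of `Omega` all of whose eigenvalues `x` have a `K`-decomposition `x = α + β`, with
`|α| + |β| < R_f` in the archimedean case and `max (|α|, |β|) < R_f` in the
non-archimedean case. -/
def OmegaHat (n : ℕ) (f : PowerSeries K) : Set (Matrix (Fin n) (Fin n) K) :=
  {A | A ∈ Omega n f ∧ ∀ x ∈ spectrum (KcBar K) (A.map (algebraMap K (KcBar K))),
    x ∈ regularElements K ∧
    (¬ IsNonarchimedean (norm : K → ℝ) → ‖horizontal K x‖ₑ + ‖vertical K x‖ₑ < convRadius f) ∧
    (IsNonarchimedean (norm : K → ℝ) → max ‖horizontal K x‖ₑ ‖vertical K x‖ₑ < convRadius f)}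

/-- The `m`-th term of the series `R f(x)`. -/
noncomputable def realTerm (f : PowerSeries K) (x : KcBar K) (m : ℕ) : KcBar K :=
  algebraMap K (KcBar K) (PowerSeries.coeff m f) *
    ∑ h ∈ Finset.range (m / 2 + 1), (m.choose (2 * h) : KcBar K) *
      algebraMap K (KcBar K) (horizontal K x) ^ (m - 2 * h) * vertical K x ^ (2 * h)

/-- The `m`-th term of the series `I f(x)`, for the choice `i` of a square root of `-1`. -/
noncomputable def imagTerm (f : PowerSeries K) (i x : KcBar K) (m : ℕ) : KcBar K :=
  -i * (algebraMap K (KcBar K) (PowerSeries.coeff m f) *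
    ∑ h ∈ Finset.Icc 1 ((m + 1) / 2), (m.choose (2 * h - 1) : KcBar K) *
      algebraMap K (KcBar K) (horizontal K x) ^ (m + 1 - 2 * h) * vertical K x ^ (2 * h - 1))

/-- `R f(x)`, as an element of the completion of the algebraic closure of `K^c`. -/
noncomputable def realSeries (f : PowerSeries K) (x : KcBar K) : KcBarC K :=
  ∑' m : ℕ, (realTerm f x m : KcBarC K)

/-- `I f(x)`, as an element of the completion of the algebraic closure of `K^c`. -/
noncomputable def imagSeries (f : PowerSeries K) (i x : KcBar K) : KcBarC K :=
  ∑' m : ℕ, (imagTerm f i x m : KcBarC K)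

end Series

/-! Polynomials in a semisimple matrix are determined by their values on the spectrum
(`aeval_eq_of_eq_on_spectrum`). Hence every relation between `M`, the `A k` and the `B j` becomes a
relation between numbers, checked at `0`, at the `γ k`, and at the pairs `α j ± β j` formed from the
horizontal and vertical components. The splitting bound makes each eigenvalue outside `K` quadratic,
so `β j ^ 2 = δ j` lies in `K`. There are then polynomials over `K` that are `1` at one `γ k`, or `±
β k` at one pair, and `0` at all other points (`exists_polynomial_eq_indicator`,
`exists_polynomial_eq_vertical`). Evaluated at `M` they are the matrices `A k` and `B k`. Comparison
with the Lagrange polynomials over `L` identifies them with expressions in the Frobenius covariants,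
which shows that these expressions have entries in `K`. For powers, `(α ± β) ^ m = E ± O * β` with
`E` and `O` in `K` (`evenPart`, `oddPart`), so `M ^ m` is a combination of the `A k`, the `B j ^ 2`
and the `B j` with coefficients `γ k ^ m`, `E / δ j` and `O` (`exists_fineFrobeniusDecomposition`).
Multiplying by the coefficients of `f` and summing gives the formula for `f(M)`. The definition of
`OmegaHat` is what makes the coefficient series converge absolutely (`exists_summable_bound`). Their
terms lie in `K`, so their sums lie in `K^c`. -/

/-! ### Polynomials vanishing on the spectrum of a semisimple matrix. -/

open Polynomial in
theorem aeval_eq_zero_of_conj_diagonal {K L : Type*} [Field K] [Field L] [Algebra K L] {n : ℕ}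
    {M : Matrix (Fin n) (Fin n) K} (φ : AlgebraicClosure K →ₐ[K] L) (hM : IsSemisimpleMatrix M)
    {p : L[X]} (hp : ∀ x ∈ spectrum L (M.map (algebraMap K L)), p.eval x = 0) :
    aeval (M.map (algebraMap K L)) p = 0 := by
  obtain ⟨P, d, h⟩ := hM
  -- The diagonalization is given over `AlgebraicClosure K`; `φ` transports it to `L`, where the
  -- diagonal entries become eigenvalues.
  let Q : (Matrix (Fin n) (Fin n) L)ˣ := Units.map (MonoidHomClass.toMonoidHom (φ.mapMatrix (m := Fin n))) P
  have hN : M.map (algebraMap K L) = Q * Matrix.diagonal (φ ∘ d) * (Q⁻¹ :) := by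
    have := congrArg φ.mapMatrix h
    rw [map_mul, map_mul] at this
    have h1 : φ.mapMatrix (M.map (algebraMap K (AlgebraicClosure K))) = M.map (algebraMap K L) := by
      ext i j; simp
    have h2 : φ.mapMatrix (Matrix.diagonal d) = Matrix.diagonal (φ ∘ d) := by
      ext i j; simp [Matrix.diagonal, apply_ite φ]
    rw [h1, h2] at this
    rw [this]; rfl
  have hs : ∀ i, φ (d i) ∈ spectrum L (M.map (algebraMap K L)) := fun i => by
    rw [hN, spectrum.units_conjugate, spectrum_diagonal]
    exact ⟨i, rfl⟩
  have hd : aeval (Matrix.diagonal (φ ∘ d)) p = 0 := by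
    have h1 : Matrix.diagonal (φ ∘ d) = Matrix.diagonalAlgHom (n := Fin n) L (φ ∘ d) := rfl
    rw [h1, aeval_algHom_apply]
    have : aeval (φ ∘ d) p = 0 := by
      ext i
      rw [← Pi.evalAlgHom_apply L (fun _ : Fin n => L) i (aeval (φ ∘ d) p), ← aeval_algHom_apply]
      simpa [coe_aeval_eq_eval] using hp _ (hs i)
    rw [this, map_zero]
  let e : Matrix (Fin n) (Fin n) L ≃ₐ[L] Matrix (Fin n) (Fin n) L :=
    MulSemiringAction.toAlgEquiv L _ (ConjAct.toConjAct Q)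
  have he : ∀ x, e x = Q * x * (Q⁻¹ :) := fun x => ConjAct.units_smul_def _ _
  rw [hN, ← he, ← e.coe_toAlgHom, aeval_algHom_apply, hd, map_zero]

/-! ### Quadratic elements: conjugation, horizontal and vertical components. -/

/-- A polynomial over `K` acts on `α ± β` with `β ^ 2 ∈ K` through conjugate values. -/
theorem exists_aeval_add_sub {K L : Type*} [Field K] [Field L] [Algebra K L] {α δ : K} {β : L}
    (hβ : β ^ 2 = algebraMap K L δ) (p : Polynomial K) :
    ∃ u v : K, Polynomial.aeval (algebraMap K L α + β) p = algebraMap K L u + algebraMap K L v * β ∧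
      Polynomial.aeval (algebraMap K L α - β) p = algebraMap K L u - algebraMap K L v * β := by
  induction p using Polynomial.induction_on' with
  | add p q hp hq =>
    obtain ⟨u, v, h1, h2⟩ := hp
    obtain ⟨u', v', h3, h4⟩ := hq
    refine ⟨u + u', v + v', ?_, ?_⟩
    · rw [map_add, h1, h3, map_add, map_add]; ring
    · rw [map_add, h2, h4, map_add, map_add]; ring
  | monomial m c =>
    induction m with
    | zero => exact ⟨c, 0, by simp, by simp⟩
    | succ m ih =>
      obtain ⟨u, v, h1, h2⟩ := ih
      refine ⟨u * α + v * δ, u + v * α, ?_, ?_⟩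
      · rw [← Polynomial.monomial_mul_X, map_mul, h1, Polynomial.aeval_X]
        simp only [map_add, map_mul, ← hβ]; ring
      · rw [← Polynomial.monomial_mul_X, map_mul, h2, Polynomial.aeval_X]
        simp only [map_add, map_mul, ← hβ]; ring

theorem horizontal_algebraMap {K L : Type*} [Field K] [Field L] [Algebra K L] (a : K) :
    horizontal K (algebraMap K L a) = a := by
  simp [horizontal, minpoly.eq_X_sub_C]

/-- The minimal polynomial is `(X - a) ^ 2 - c`: a root `z` in `K` would force `y = ± (z - a)`, and
a quadratic without roots is irreducible. -/
theorem horizontal_add {K L : Type*} [Field K] [Field L] [Algebra K L] (h2 : (2 : K) ≠ 0)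
    {a c : K} {y : L} (hy : y ^ 2 = algebraMap K L c) (hyK : y ∉ Set.range (algebraMap K L)) :
    horizontal K (algebraMap K L a + y) = a := by
  open Polynomial in
  have hp : minpoly K (algebraMap K L a + y) = X ^ 2 + C (-2 * a) * X + C (a ^ 2 - c) := by
    symm
    have hd : (X ^ 2 + C (-2 * a) * X + C (a ^ 2 - c) : K[X]).natDegree = 2 := by compute_degree!
    have hm : (X ^ 2 + C (-2 * a) * X + C (a ^ 2 - c) : K[X]).Monic := by monicity!
    refine minpoly.eq_of_irreducible_of_monic ?_ ?_ hm
    · refine irreducible_of_degree_le_three_of_not_isRoot (by rw [hd]; decide) fun z hz => ?_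
      have hz' : (z - a) ^ 2 = c := by
        simp only [IsRoot, eval_add, eval_pow, eval_X, eval_mul, eval_C] at hz
        linear_combination hz
      have : (y - algebraMap K L (z - a)) * (y + algebraMap K L (z - a)) = 0 := by
        have := congrArg (algebraMap K L) hz'
        rw [map_pow] at this
        linear_combination hy - this
      rcases mul_eq_zero.1 this with h | h
      · exact hyK ⟨z - a, (sub_eq_zero.1 h).symm⟩
      · exact hyK ⟨-(z - a), by rw [map_neg]; linear_combination -h⟩
    · simp only [map_add, map_mul, map_pow, aeval_X, aeval_C, map_sub, ← hy, map_neg, map_ofNat]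
      ring
  have hd : (minpoly K (algebraMap K L a + y)).natDegree = 2 := by
    rw [hp]; open Polynomial in compute_degree!
  rw [horizontal, hd, hp]
  have h0 : (Polynomial.C (a ^ 2 - c)).coeff 1 = 0 := Polynomial.coeff_C_succ
  simp only [Polynomial.coeff_add, Polynomial.coeff_X_pow, Polynomial.coeff_C_mul,
    Nat.add_one_sub_one, h0, Polynomial.coeff_X_one, Nat.cast_ofNat]
  simp
  field_simp

/-- On `K + K β` the involution is Galois conjugation, although on all of `L` it need not respect
products. The case `b = 0` is separate because the element then has degree one. -/
theorem involution_add {K L : Type*} [Field K] [Field L] [Algebra K L] (h2 : (2 : K) ≠ 0)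
    {δ : K} {β : L} (hβ : β ^ 2 = algebraMap K L δ) (hβK : β ∉ Set.range (algebraMap K L))
    (a b : K) :
    involution K (algebraMap K L a + algebraMap K L b * β) =
      algebraMap K L a - algebraMap K L b * β := by
  by_cases hb : b = 0
  · simp [hb, involution, vertical, horizontal_algebraMap]
  · have hb' : algebraMap K L b ≠ 0 := by simpa using hb
    have := horizontal_add h2 (a := a) (c := b ^ 2 * δ) (y := algebraMap K L b * β)
      (by rw [mul_pow, hβ, map_mul, map_pow]) (by
        rintro ⟨z, hz⟩
        exact hβK ⟨b⁻¹ * z, by rw [map_mul, hz, map_inv₀]; field_simp⟩)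
    rw [involution, vertical, this]; ring

/-- Completing the square in `x ^ 2 + a₁ x + a₀ = 0`, where the vertical component is `x + a₁ / 2`.
-/
theorem vertical_sq_mem {K L : Type*} [Field K] [Field L] [Algebra K L] (h2 : (2 : K) ≠ 0)
    {x : L} (hx : IsIntegral K x) (hd : (minpoly K x).natDegree = 2) :
    ∃ δ : K, vertical K x ^ 2 = algebraMap K L δ := by
  have h := minpoly.aeval K x
  have hm := (minpoly.monic hx).coeff_natDegree
  rw [hd] at hm
  rw [Polynomial.aeval_eq_sum_range, hd] at h
  simp only [Finset.sum_range_succ, Finset.sum_range_zero, hm, Algebra.smul_def, map_one] at h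
  have h2' : (2 : L) ≠ 0 := by
    rw [← map_ofNat (algebraMap K L) 2]
    exact (map_ne_zero (algebraMap K L)).2 h2
  refine ⟨(minpoly K x).coeff 1 ^ 2 / 4 - (minpoly K x).coeff 0, ?_⟩
  have h4 : (4 : L) ≠ 0 := by
    have : (4 : L) = 2 * 2 := by norm_num
    rw [this]; exact mul_ne_zero h2' h2'
  rw [vertical, horizontal, hd]
  simp only [map_neg, map_div₀, map_sub, map_pow, map_ofNat, Nat.cast_ofNat,
    Nat.add_one_sub_one] at h ⊢
  field_simp
  linear_combination 16 * h

/-! ### Eigenvalues, minimal polynomials, and equality of polynomials in `M`. -/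

/-- By spectral mapping, `p(x)` is an eigenvalue of `p(M) = 0`, and a nonzero scalar is not. -/
theorem aeval_eq_zero_of_mem_spectrum {K L : Type*} [Field K] [Field L] [Algebra K L] {n : ℕ}
    {M : Matrix (Fin n) (Fin n) K} {x : L} (hxs : x ∈ spectrum L (M.map (algebraMap K L)))
    {p : Polynomial K} (hp : Polynomial.aeval M p = 0) : Polynomial.aeval x p = 0 := by
  have h1 := spectrum.subset_polynomial_aeval (M.map (algebraMap K L))
    (p.map (algebraMap K L)) ⟨x, hxs, rfl⟩
  have h2 : Polynomial.aeval (M.map (algebraMap K L)) (p.map (algebraMap K L)) = 0 := by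
    rw [Polynomial.aeval_map_algebraMap]
    have : M.map (algebraMap K L) = (Algebra.ofId K L).mapMatrix M := rfl
    rw [this, Polynomial.aeval_algHom_apply, hp, map_zero]
  rw [h2] at h1
  simp only [Polynomial.eval_map_algebraMap] at h1
  by_contra hne
  refine spectrum.mem_iff.1 h1 ?_
  rw [sub_zero]
  exact (IsUnit.mk0 _ hne).map (algebraMap L (Matrix (Fin n) (Fin n) L))

/-- The minimal polynomial of an eigenvalue is an irreducible factor of that of `M`, hence one of
those measured by the splitting bound. -/
theorem natDegree_minpoly_le_two {K L : Type*} [Field K] [Field L] [Algebra K L] {n : ℕ}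
    {M : Matrix (Fin n) (Fin n) K} (hsb : M.splittingBound K ≤ 2) {x : L} (hx : IsIntegral K x)
    (hxs : x ∈ spectrum L (M.map (algebraMap K L))) : (minpoly K x).natDegree ≤ 2 := by
  have hdvd := minpoly.dvd K x (aeval_eq_zero_of_mem_spectrum hxs (minpoly.aeval K M))
  have : ((minpoly K x).natDegree : ℕ∞) ≤ M.splittingBound K :=
    le_iSup₂_of_le (f := fun q (_ : q ∈ {q : Polynomial K | Irreducible q ∧
      q ∣ (minpoly K M).map (algebraMap K K)}) => (q.natDegree : ℕ∞)) (minpoly K x)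
      ⟨minpoly.irreducible hx, by simpa using hdvd⟩ le_rfl
  exact_mod_cast this.trans hsb

open Polynomial in
/-- Over `K`, polynomials in `M` agreeing on the spectrum agree. -/
theorem aeval_eq_of_eq_on_spectrum {K L : Type*} [Field K] [Field L] [Algebra K L] {n : ℕ}
    {M : Matrix (Fin n) (Fin n) K} (φ : AlgebraicClosure K →ₐ[K] L) (hM : IsSemisimpleMatrix M)
    {p q : K[X]} (hp : ∀ x ∈ spectrum L (M.map (algebraMap K L)), aeval x p = aeval x q) :
    aeval M p = aeval M q := by
  have h := aeval_eq_zero_of_conj_diagonal (p := (p - q).map (algebraMap K L)) φ hM fun x hx => by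
    rw [eval_map_algebraMap, map_sub, hp x hx, sub_self]
  rw [aeval_map_algebraMap] at h
  have h1 : M.map (algebraMap K L) = (Algebra.ofId K L).mapMatrix M := rfl
  rw [h1, aeval_algHom_apply, map_sub] at h
  have := Matrix.map_injective (algebraMap K L).injective
    (a₁ := aeval M p - aeval M q) (a₂ := 0) (by ext i j; simpa using congrFun (congrFun h i) j)
  exact sub_eq_zero.1 this

-- This is how matrices defined through Lagrange polynomials over `L` are shown to have entries in
-- `K`.
open Polynomial in
theorem map_aeval_eq_aeval_of_eq_on_spectrum {K L : Type*} [Field K] [Field L] [Algebra K L] {n : ℕ}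
    {M : Matrix (Fin n) (Fin n) K} (φ : AlgebraicClosure K →ₐ[K] L) (hM : IsSemisimpleMatrix M)
    {p : K[X]} {q : L[X]}
    (hp : ∀ x ∈ spectrum L (M.map (algebraMap K L)), aeval x p = eval x q) :
    (aeval M p).map (algebraMap K L) = aeval (M.map (algebraMap K L)) q := by
  have h := aeval_eq_zero_of_conj_diagonal (p := p.map (algebraMap K L) - q) φ hM fun x hx => by
    rw [eval_sub, eval_map_algebraMap, hp x hx, sub_self]
  rw [map_sub, aeval_map_algebraMap] at h
  have h1 : M.map (algebraMap K L) = (Algebra.ofId K L).mapMatrix M := rfl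
  rw [← sub_eq_zero.1 h, h1, aeval_algHom_apply]
  rfl

/-! ### Interpolation over `K` at rational points and conjugate pairs. -/

open Polynomial in
/-- A polynomial of `K[X]` separating a nonzero `γ k` from the other points. -/
theorem exists_polynomial_eq_indicator {K L : Type*} [Field K] [Field L] [Algebra K L] {s t : ℕ}
    {γ : Fin s → K} (hγ0 : ∀ i, γ i ≠ 0) (hγ : Function.Injective γ) {α δ : Fin t → K}
    {β : Fin t → L} (hβ : ∀ j, β j ^ 2 = algebraMap K L (δ j))
    (hβK : ∀ j, β j ∉ Set.range (algebraMap K L)) (k : Fin s) :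
    ∃ a : K[X], aeval (0 : L) a = 0 ∧
      (∀ i, aeval (algebraMap K L (γ i)) a = if i = k then (1 : L) else 0) ∧
      ∀ j, aeval (algebraMap K L (α j) + β j) a = 0 ∧ aeval (algebraMap K L (α j) - β j) a = 0 := by
  -- The quadratic factor kills both members of a conjugate pair while keeping coefficients in `K`;
  -- the factor `X` handles the possible eigenvalue `0`.
  let Q : K[X] := X * (∏ i ∈ Finset.univ.erase k, (X - C (γ i))) *
    ∏ j, ((X - C (α j)) ^ 2 - C (δ j))
  have hc : Q.eval (γ k) ≠ 0 := by
    simp only [Q, eval_mul, eval_X, eval_prod, eval_sub, eval_pow, eval_C]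
    refine mul_ne_zero (mul_ne_zero (hγ0 k) ?_) ?_
    · refine Finset.prod_ne_zero_iff.2 fun i hi => sub_ne_zero.2 fun h => ?_
      exact (Finset.mem_erase.1 hi).1 (hγ h).symm
    · refine Finset.prod_ne_zero_iff.2 fun j _ h => ?_
      have h1 := congrArg (algebraMap K L) h
      rw [map_sub, map_pow, map_zero, ← hβ] at h1
      have h2 : (algebraMap K L (γ k - α j) - β j) * (algebraMap K L (γ k - α j) + β j) = 0 := by
        linear_combination h1
      rcases mul_eq_zero.1 h2 with h | h
      · exact hβK j ⟨_, sub_eq_zero.1 h⟩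
      · exact hβK j ⟨-(γ k - α j), by rw [map_neg]; linear_combination -h⟩
  have hγQ : ∀ i, aeval (algebraMap K L (γ i)) Q = algebraMap K L (Q.eval (γ i)) := fun i =>
    aeval_algebraMap_apply_eq_algebraMap_eval _ _
  refine ⟨C (Q.eval (γ k))⁻¹ * Q, by simp [Q], fun i => ?_, fun j => ?_⟩
  · rw [map_mul, aeval_C, hγQ, ← map_mul]
    split_ifs with h
    · rw [h, inv_mul_cancel₀ hc, map_one]
    · have : Q.eval (γ i) = 0 := by
        simp only [Q, eval_mul, eval_prod]
        rw [Finset.prod_eq_zero (i := i) (by simp [h]) (by simp)]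
        simp
      rw [this, mul_zero, map_zero]
  · constructor <;>
    · rw [map_mul]
      refine mul_eq_zero_of_right _ ?_
      simp only [Q, map_mul, map_prod]
      rw [Finset.prod_eq_zero (s := Finset.univ) (i := j) (Finset.mem_univ _) (by simp [hβ])]
      simp

open Polynomial in
/-- A polynomial of `K[X]` taking the values `± β j` at `α j ± β j`, vanishing at the other
points. -/
theorem exists_polynomial_eq_vertical {K L : Type*} [Field K] [Field L] [Algebra K L] {s t : ℕ}
    {γ : Fin s → K} {α δ : Fin t → K}
    {β : Fin t → L} (hβ : ∀ j, β j ^ 2 = algebraMap K L (δ j))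
    (hβK : ∀ j, β j ∉ Set.range (algebraMap K L))
    (hne : ∀ j l, j ≠ l → algebraMap K L (α j) + β j ≠ algebraMap K L (α l) + β l ∧
      algebraMap K L (α j) + β j ≠ algebraMap K L (α l) - β l) (k : Fin t) :
    ∃ b : K[X], aeval (0 : L) b = 0 ∧ (∀ i, aeval (algebraMap K L (γ i)) b = 0) ∧
      ∀ j, aeval (algebraMap K L (α j) + β j) b = (if j = k then β k else 0) ∧
        aeval (algebraMap K L (α j) - β j) b = (if j = k then - β k else 0) := by
  let Q : K[X] := X * (∏ i, (X - C (γ i))) *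
    ∏ j ∈ Finset.univ.erase k, ((X - C (α j)) ^ 2 - C (δ j))
  have hK : ∀ z : K, algebraMap K L (α k) + β k ≠ algebraMap K L z := fun z hz =>
    hβK k ⟨z - α k, by rw [map_sub, ← hz]; ring⟩
  have hc : aeval (algebraMap K L (α k) + β k) Q ≠ 0 := by
    simp only [Q, map_mul, aeval_X, map_prod, map_sub, map_pow, aeval_C]
    refine mul_ne_zero (mul_ne_zero ?_ ?_) ?_
    · simpa using hK 0
    · exact Finset.prod_ne_zero_iff.2 fun i hi => sub_ne_zero.2 (hK _)
    · refine Finset.prod_ne_zero_iff.2 fun j hj h => ?_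
      obtain ⟨h1, h2⟩ := hne k j (Finset.mem_erase.1 hj).1.symm
      rw [← hβ] at h
      have h3 : (algebraMap K L (α k) + β k - (algebraMap K L (α j) + β j)) *
          (algebraMap K L (α k) + β k - (algebraMap K L (α j) - β j)) = 0 := by
        linear_combination h
      exact (mul_ne_zero (sub_ne_zero.2 h1) (sub_ne_zero.2 h2)) h3
  obtain ⟨u, v, h1, h2⟩ := exists_aeval_add_sub (hβ k) (α := α k) Q
  rw [h1] at hc
  -- The conjugate value is nonzero too: otherwise `β k` would be `u / v`, or `u = v = 0`.
  have hc2 : algebraMap K L u - algebraMap K L v * β k ≠ 0 := fun h => by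
    by_cases hv : v = 0
    · simp only [hv, map_zero, zero_mul, add_zero, sub_zero] at h hc
      exact hc h
    · have hv' : algebraMap K L v ≠ 0 := by simpa using hv
      exact hβK k ⟨v⁻¹ * u, by rw [map_mul, map_inv₀]; field_simp; linear_combination h⟩
  have hD : u ^ 2 - v ^ 2 * δ k ≠ 0 := fun h => by
    have := congrArg (algebraMap K L) h
    rw [map_sub, map_mul, map_pow, map_pow, ← hβ, map_zero] at this
    refine mul_ne_zero hc hc2 ?_
    linear_combination this
  -- `D` is the norm of `u + v β k`, the value of `Q` at `α k + β k`. The linear `q` must take there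
  -- the value `β k / (u + v β k) = (-v δ k + u β k) / D`, which dictates its two coefficients.
  set D := u ^ 2 - v ^ 2 * δ k with hDdef
  let q : K[X] := C (-(v * δ k) / D) + C (u / D) * (X - C (α k))
  have e1 : -(v * δ k) / D * u + u / D * v * δ k = 0 := by field_simp; ring
  have e2 : -(v * δ k) / D * v + u / D * u = 1 := by field_simp; rw [hDdef]; ring
  replace e1 := congrArg (algebraMap K L) e1
  replace e2 := congrArg (algebraMap K L) e2
  simp only [map_add, map_mul, map_zero, map_one, ← hβ] at e1 e2
  refine ⟨q * Q, by simp [Q], fun i => ?_, fun j => ?_⟩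
  · simp only [Q, map_mul, map_prod]
    rw [Finset.prod_eq_zero (s := Finset.univ) (i := i) (Finset.mem_univ _) (by simp)]
    simp
  · by_cases h : j = k
    · subst h
      rw [map_mul, h1, map_mul, h2, if_pos rfl, if_pos rfl]
      simp only [q, map_add, map_mul, map_sub, aeval_C, aeval_X]
      constructor
      · linear_combination e1 + β j * e2
      · linear_combination e1 - β j * e2
    · rw [if_neg h, if_neg h]
      constructor <;>
      · simp only [Q, map_mul, map_prod]
        rw [Finset.prod_eq_zero (s := Finset.univ.erase k) (i := j) (by simp [h]) (by simp [hβ])]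
        simp

/-! ### Even and odd parts of a binomial power. -/

theorem sum_range_succ_eq_even_add_odd {R : Type*} [AddCommMonoid R] (g : ℕ → R) (m : ℕ) :
    ∑ k ∈ Finset.range (m + 1), g k =
      ∑ h ∈ Finset.range (m / 2 + 1), g (2 * h) + ∑ h ∈ Finset.Icc 1 ((m + 1) / 2), g (2 * h - 1) := by
  induction m with
  | zero => simp
  | succ m ih =>
    rw [Finset.sum_range_succ, ih]
    rcases Nat.even_or_odd' m with ⟨c, rfl | rfl⟩
    · have h1 : (2 * c + 1) / 2 = c := by omega
      have h2 : (2 * c + 1 + 1) / 2 = c + 1 := by omega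
      have h3 : 2 * c / 2 = c := by omega
      rw [h1, h2, h3, Finset.sum_Icc_succ_top (by omega), add_assoc]
      rfl
    · have h1 : (2 * c + 1) / 2 = c := by omega
      have h2 : (2 * c + 1 + 1) / 2 = c + 1 := by omega
      have h3 : (2 * c + 1 + 1 + 1) / 2 = c + 1 := by omega
      rw [h1, h2, h3, Finset.sum_range_succ _ (c + 1), add_right_comm]
      rfl

section Parts

variable {R : Type*} [CommRing R]

/-- The part of `(α + β) ^ m` that is even in `β`, as a polynomial in `α` and `δ = β ^ 2`. -/
def evenPart (α δ : R) (m : ℕ) : R :=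
  ∑ h ∈ Finset.range (m / 2 + 1), (m.choose (2 * h) : R) * α ^ (m - 2 * h) * δ ^ h

/-- The part of `(α + β) ^ m` that is odd in `β`, divided by `β`, as a polynomial in `α` and
`δ = β ^ 2`. -/
def oddPart (α δ : R) (m : ℕ) : R :=
  ∑ h ∈ Finset.Icc 1 ((m + 1) / 2), (m.choose (2 * h - 1) : R) * α ^ (m + 1 - 2 * h) * δ ^ (h - 1)

theorem oddPart_mul (α β : R) (m : ℕ) : oddPart α (β ^ 2) m * β =
    ∑ h ∈ Finset.Icc 1 ((m + 1) / 2), (m.choose (2 * h - 1) : R) * α ^ (m + 1 - 2 * h) *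
      β ^ (2 * h - 1) := by
  rw [oddPart, Finset.sum_mul]
  refine Finset.sum_congr rfl fun h hh => ?_
  have h1 := (Finset.mem_Icc.1 hh).1
  have : 2 * h - 1 = 2 * (h - 1) + 1 := by omega
  rw [this, pow_succ β (2 * (h - 1)), pow_mul]; ring

theorem add_pow_eq_evenPart_add_oddPart (α β : R) (m : ℕ) :
    (α + β) ^ m = evenPart α (β ^ 2) m + oddPart α (β ^ 2) m * β := by
  rw [oddPart_mul, add_comm, add_pow, sum_range_succ_eq_even_add_odd, evenPart]
  congr 1
  · refine Finset.sum_congr rfl fun h _ => ?_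
    rw [← pow_mul]; ring
  · refine Finset.sum_congr rfl fun h hh => ?_
    have h1 := (Finset.mem_Icc.1 hh).1
    have : m - (2 * h - 1) = m + 1 - 2 * h := by omega
    rw [this]; ring

theorem map_evenPart {S : Type*} [CommRing S] (φ : R →+* S) (α δ : R) (m : ℕ) :
    φ (evenPart α δ m) = evenPart (φ α) (φ δ) m := by
  simp [evenPart]

theorem map_oddPart {S : Type*} [CommRing S] (φ : R →+* S) (α δ : R) (m : ℕ) :
    φ (oddPart α δ m) = oddPart (φ α) (φ δ) m := by
  simp [oddPart]

end Parts

/-! ### Norm estimates for the two parts. -/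

section Norms

/-- Binomial coefficients have norm at most one in an ultrametric field. -/
theorem norm_choose_mul_le_of_isUltrametricDist {L : Type*} [NormedField L] [IsUltrametricDist L]
    {α β : L} {m k l : ℕ} (h : l + k = m) :
    ‖(m.choose k : L) * α ^ l * β ^ k‖ ≤ max ‖α‖ ‖β‖ ^ m := by
  rw [norm_mul, norm_mul, norm_pow, norm_pow, ← h, pow_add, mul_assoc]
  refine (mul_le_of_le_one_left (by positivity) (IsUltrametricDist.norm_natCast_le_one L _)).trans ?_
  gcongr
  · exact le_max_left _ _
  · exact le_max_right _ _

theorem norm_evenPart_le_of_isUltrametricDist {L : Type*} [NormedField L] [IsUltrametricDist L]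
    (α β : L) (m : ℕ) : ‖evenPart α (β ^ 2) m‖ ≤ max ‖α‖ ‖β‖ ^ m := by
  refine IsUltrametricDist.norm_sum_le_of_forall_le_of_nonneg (by positivity) fun h hh => ?_
  rw [← pow_mul]
  exact norm_choose_mul_le_of_isUltrametricDist (by have := Finset.mem_range.1 hh; omega)

theorem norm_oddPart_mul_le_of_isUltrametricDist {L : Type*} [NormedField L] [IsUltrametricDist L]
    (α β : L) (m : ℕ) : ‖oddPart α (β ^ 2) m * β‖ ≤ max ‖α‖ ‖β‖ ^ m := by
  rw [oddPart_mul]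
  refine IsUltrametricDist.norm_sum_le_of_forall_le_of_nonneg (by positivity) fun h hh => ?_
  exact norm_choose_mul_le_of_isUltrametricDist (by have := Finset.mem_Icc.1 hh; omega)

theorem norm_natCast_mul_pow_le {L : Type*} [NormedField L] (α β : L) (c k l : ℕ) :
    ‖(c : L) * α ^ l * β ^ k‖ ≤ c * ‖α‖ ^ l * ‖β‖ ^ k := by
  rw [norm_mul, norm_mul, norm_pow, norm_pow]
  gcongr
  simpa using Nat.norm_cast_le (α := L) c

/-- The even/odd splitting is applied again, to the real numbers `‖α‖` and `‖β‖`; both real parts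
are nonnegative, so each is at most the full power. -/
theorem norm_evenPart_le {L : Type*} [NormedField L] (α β : L) (m : ℕ) :
    ‖evenPart α (β ^ 2) m‖ ≤ (‖α‖ + ‖β‖) ^ m := by
  rw [add_pow_eq_evenPart_add_oddPart]
  refine le_add_of_le_of_nonneg ?_ (by unfold oddPart; positivity)
  refine (norm_sum_le _ _).trans (Finset.sum_le_sum fun h _ => ?_)
  rw [← pow_mul, ← pow_mul]
  exact norm_natCast_mul_pow_le _ _ _ _ _

theorem norm_oddPart_mul_le {L : Type*} [NormedField L] (α β : L) (m : ℕ) :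
    ‖oddPart α (β ^ 2) m * β‖ ≤ (‖α‖ + ‖β‖) ^ m := by
  rw [add_pow_eq_evenPart_add_oddPart]
  refine le_add_of_nonneg_of_le (by unfold evenPart; positivity) ?_
  rw [oddPart_mul, oddPart_mul]
  refine (norm_sum_le _ _).trans (Finset.sum_le_sum fun h _ => ?_)
  exact norm_natCast_mul_pow_le _ _ _ _ _

theorem summable_norm_coeff_mul_pow {K : Type*} [NormedField K] (f : PowerSeries K) {r : NNReal}
    (hr : (r : ENNReal) < convRadius f) :
    Summable fun m : ℕ => ‖PowerSeries.coeff m f‖ * (r : ℝ) ^ m := by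
  have := FormalMultilinearSeries.summable_norm_mul_pow _ hr
  simpa [FormalMultilinearSeries.ofScalars_norm] using this

end Norms

section Valued

variable {K : Type*} [NormedField K]

theorem norm_algebraMap_KcBar (x : K) : ‖algebraMap K (KcBar K) x‖ = ‖x‖ := norm_algebraMap' _ x

/-- A norm is ultrametric as soon as the natural numbers have norm at most one, and these already
lie in `K`. -/
theorem isUltrametricDist_KcBar (h : IsNonarchimedean (norm : K → ℝ)) :
    IsUltrametricDist (KcBar K) := by
  refine IsUltrametricDist.isUltrametricDist_of_forall_norm_natCast_le_one fun m => ?_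
  rw [← map_natCast (algebraMap K (KcBar K)), norm_algebraMap_KcBar]
  have : IsUltrametricDist K := ⟨fun x y z => by
    have := h (x - y) (y - z)
    rwa [sub_add_sub_cancel, ← dist_eq_norm, ← dist_eq_norm, ← dist_eq_norm] at this⟩
  exact IsUltrametricDist.norm_natCast_le_one K m

/-- The norms of the two components of `x ^ m` are dominated by a sequence whose product with the
coefficients of `f` is summable. -/
theorem exists_summable_bound (f : PowerSeries K) (x : KcBar K)
    (h1 : ¬ IsNonarchimedean (norm : K → ℝ) →
      ‖horizontal K x‖ₑ + ‖vertical K x‖ₑ < convRadius f)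
    (h2 : IsNonarchimedean (norm : K → ℝ) →
      max ‖horizontal K x‖ₑ ‖vertical K x‖ₑ < convRadius f) :
    ∃ r : ℝ, (Summable fun m : ℕ => ‖PowerSeries.coeff m f‖ * r ^ m) ∧ ∀ m,
      ‖evenPart (algebraMap K (KcBar K) (horizontal K x)) (vertical K x ^ 2) m‖ ≤ r ^ m ∧
      ‖oddPart (algebraMap K (KcBar K) (horizontal K x)) (vertical K x ^ 2) m * vertical K x‖ ≤
        r ^ m := by
  -- The ratio `r` is the maximum of the two norms in the ultrametric case and their sum otherwise,
  -- exactly the quantities compared with `convRadius f`.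
  by_cases h : IsNonarchimedean (norm : K → ℝ)
  · have := isUltrametricDist_KcBar h
    refine ⟨max ‖algebraMap K (KcBar K) (horizontal K x)‖ ‖vertical K x‖, ?_, fun m =>
      ⟨norm_evenPart_le_of_isUltrametricDist _ _ m, norm_oddPart_mul_le_of_isUltrametricDist _ _ m⟩⟩
    rw [norm_algebraMap_KcBar]
    exact summable_norm_coeff_mul_pow (r := max ‖horizontal K x‖₊ ‖vertical K x‖₊) f (by
      simpa [enorm] using h2 h)
  · refine ⟨‖algebraMap K (KcBar K) (horizontal K x)‖ + ‖vertical K x‖, ?_, fun m =>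
      ⟨norm_evenPart_le _ _ m, norm_oddPart_mul_le _ _ m⟩⟩
    rw [norm_algebraMap_KcBar]
    exact summable_norm_coeff_mul_pow (r := ‖horizontal K x‖₊ + ‖vertical K x‖₊) f (by
      simpa [enorm] using h1 h)

theorem realTerm_eq (f : PowerSeries K) (x : KcBar K) (m : ℕ) :
    realTerm f x m = algebraMap K (KcBar K) (PowerSeries.coeff m f) *
      evenPart (algebraMap K (KcBar K) (horizontal K x)) (vertical K x ^ 2) m := by
  simp only [realTerm, evenPart, pow_mul]

theorem imagTerm_eq (f : PowerSeries K) (i x : KcBar K) (m : ℕ) :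
    imagTerm f i x m = -i * (algebraMap K (KcBar K) (PowerSeries.coeff m f) *
      (oddPart (algebraMap K (KcBar K) (horizontal K x)) (vertical K x ^ 2) m * vertical K x)) := by
  rw [imagTerm, oddPart_mul]

end Valued

/-! ### The fine Frobenius decomposition and the powers of `M`. -/

section FineFrobenius

variable {K L : Type*} [Field K] [Field L] [Algebra K L] {n : ℕ}

-- All the matrices produced are polynomials in `M` over `K`, so each relation is tested pointwise
-- on the spectrum. The sign convention is `ν j = -β j ^ 2`.
open Polynomial in
theorem exists_fineFrobeniusDecomposition (h2 : (2 : K) ≠ 0) (φ : AlgebraicClosure K →ₐ[K] L)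
    {M : Matrix (Fin n) (Fin n) K} (hM : M ≠ 0) (hss : IsSemisimpleMatrix M)
    (hsb : M.splittingBound K ≤ 2)
    (hint : ∀ x ∈ spectrum L (M.map (algebraMap K L)), IsIntegral K x)
    {s t : ℕ} {γ : Fin s → K} {lam : Fin t → L} (hlist : IsEigenvalueListing M γ lam) :
    ∃ (A : Fin s → Matrix (Fin n) (Fin n) K) (B : Fin t → Matrix (Fin n) (Fin n) K)
      (ν : Fin t → K) (A₀ : Matrix (Fin n) (Fin n) K),
      (∀ k, (A k).map (algebraMap K L) =
        frobeniusCovariant (M.map (algebraMap K L)) (algebraMap K L (γ k))) ∧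
      (∀ j, (B j).map (algebraMap K L) = vertical K (lam j) •
        (frobeniusCovariant (M.map (algebraMap K L)) (lam j) -
          (frobeniusCovariant (M.map (algebraMap K L)) (lam j)).map (involution K))) ∧
      (∀ j, algebraMap K L (ν j) = -vertical K (lam j) ^ 2) ∧
      IsFineFrobeniusDecomposition M γ A (fun j => horizontal K (lam j)) ν B ∧
      A₀ = 1 - ∑ k, A k + ∑ j, (ν j)⁻¹ • B j ^ 2 ∧
      (∀ j, ν j ≠ 0) ∧
      ∀ m, M ^ m = (0 : K) ^ m • A₀ + ∑ k, γ k ^ m • A k +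
        ∑ j, ((evenPart (horizontal K (lam j)) (-ν j) m / -ν j) • B j ^ 2 +
          oddPart (horizontal K (lam j)) (-ν j) m • B j) := by
  classical
  have h2L : (2 : L) ≠ 0 := by
    rw [← map_ofNat (algebraMap K L) 2]
    exact (map_ne_zero (algebraMap K L)).2 h2
  set S := spectrum L (M.map (algebraMap K L))
  set α : Fin t → K := fun j => horizontal K (lam j) with hα
  set β : Fin t → L := fun j => vertical K (lam j) with hβdef
  have hlam : ∀ j, lam j = algebraMap K L (α j) + β j := fun j => by
    simp only [hα, hβdef, vertical]; ring
  have hbar : ∀ j, involution K (lam j) = algebraMap K L (α j) - β j := fun j => rfl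
  have hlamS : ∀ j, lam j ∉ Set.range (algebraMap K L) ∧ lam j ∈ S := fun j => by
    have : lam j ∈ Set.range (Sum.elim lam fun j => involution K (lam j)) := ⟨Sum.inl j, rfl⟩
    rwa [hlist.range_lam] at this
  have hbarS : ∀ j, algebraMap K L (α j) - β j ∈ S := fun j => by
    have : involution K (lam j) ∈ Set.range (Sum.elim lam fun j => involution K (lam j)) :=
      ⟨Sum.inr j, rfl⟩
    rw [hlist.range_lam] at this
    exact this.2
  have hγS : ∀ k, γ k ≠ 0 ∧ algebraMap K L (γ k) ∈ S := fun k => by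
    have : γ k ∈ Set.range γ := ⟨k, rfl⟩
    rwa [hlist.range_γ] at this
  have hβK : ∀ j, β j ∉ Set.range (algebraMap K L) := by
    rintro j ⟨z, hz⟩
    exact (hlamS j).1 ⟨α j + z, by rw [hlam, map_add, hz]⟩
  have hβ0 : ∀ j, β j ≠ 0 := fun j h => hβK j ⟨0, by rw [map_zero, h]⟩
  have hδ : ∀ j, ∃ δ : K, β j ^ 2 = algebraMap K L δ := fun j => by
    refine vertical_sq_mem h2 (hint _ (hlamS j).2) (le_antisymm
      (natDegree_minpoly_le_two hsb (hint _ (hlamS j).2) (hlamS j).2) ?_)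
    exact (minpoly.two_le_natDegree_iff (hint _ (hlamS j).2)).2 (hlamS j).1
  choose δ hδ using hδ
  have hδ0 : ∀ j, δ j ≠ 0 := fun j h => hβ0 j (by
    have := hδ j
    rw [h, map_zero] at this
    exact pow_eq_zero_iff (two_ne_zero) |>.1 this)
  have hne : ∀ j l, j ≠ l → algebraMap K L (α j) + β j ≠ algebraMap K L (α l) + β l ∧
      algebraMap K L (α j) + β j ≠ algebraMap K L (α l) - β l := fun j l hjl => by
    rw [← hlam, ← hlam, ← hbar]
    refine ⟨fun h => hjl ?_, fun h => ?_⟩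
    · simpa using hlist.lam_injective (a₁ := Sum.inl j) (a₂ := Sum.inl l) h
    · simpa using hlist.lam_injective (a₁ := Sum.inl j) (a₂ := Sum.inr l) h
  have hne' : ∀ j l, j ≠ l → algebraMap K L (α j) - β j ≠ algebraMap K L (α l) - β l :=
    fun j l hjl => by
    rw [← hbar, ← hbar]
    exact fun h => hjl (by
      simpa using hlist.lam_injective (a₁ := Sum.inr j) (a₂ := Sum.inr l) h)
  -- The point `0` is not in the listing and need not be an eigenvalue; it is included here because
  -- the interpolating polynomials are prescribed at `0` as well.
  have hS : ∀ x ∈ S, x = 0 ∨ (∃ k, x = algebraMap K L (γ k)) ∨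
      ∃ j, x = algebraMap K L (α j) + β j ∨ x = algebraMap K L (α j) - β j := fun x hx => by
    by_cases hxK : x ∈ Set.range (algebraMap K L)
    · obtain ⟨z, rfl⟩ := hxK
      by_cases hz : z = 0
      · left; rw [hz, map_zero]
      · have : z ∈ Set.range γ := by rw [hlist.range_γ]; exact ⟨hz, hx⟩
        obtain ⟨k, rfl⟩ := this
        exact Or.inr (Or.inl ⟨k, rfl⟩)
    · have : x ∈ Set.range (Sum.elim lam fun j => involution K (lam j)) := by
        rw [hlist.range_lam]; exact ⟨hxK, hx⟩
      obtain ⟨j | j, rfl⟩ := this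
      · exact Or.inr (Or.inr ⟨j, Or.inl (hlam j)⟩)
      · exact Or.inr (Or.inr ⟨j, Or.inr (hbar j)⟩)
  have heq : ∀ p q : K[X], aeval (0 : L) p = aeval (0 : L) q →
      (∀ k, aeval (algebraMap K L (γ k)) p = aeval (algebraMap K L (γ k)) q) →
      (∀ j, aeval (algebraMap K L (α j) + β j) p = aeval (algebraMap K L (α j) + β j) q) →
      (∀ j, aeval (algebraMap K L (α j) - β j) p = aeval (algebraMap K L (α j) - β j) q) →
      aeval M p = aeval M q := fun p q hp0 hpγ hpp hpm =>
    aeval_eq_of_eq_on_spectrum φ hss fun x hx => by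
      rcases hS x hx with rfl | ⟨k, rfl⟩ | ⟨j, rfl | rfl⟩
      exacts [hp0, hpγ k, hpp j, hpm j]
  choose a ha0 haγ haβ using
    exists_polynomial_eq_indicator (α := α) (fun k => (hγS k).1) hlist.γ_injective hδ hβK
  choose b hb0 hbγ hbβ using exists_polynomial_eq_vertical (γ := γ) hδ hβK hne
  have haβ1 := fun k j => (haβ k j).1
  have haβ2 := fun k j => (haβ k j).2
  have hbβ1 := fun k j => (hbβ k j).1
  have hbβ2 := fun k j => (hbβ k j).2
  -- This polynomial is `1` at `0` and `0` at every listed eigenvalue: `(-δ j)⁻¹ * b j ^ 2` is `-1`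
  -- on the `j`-th pair.
  let a₀ : K[X] := 1 - ∑ k, a k + ∑ j, C (-δ j)⁻¹ * b j ^ 2
  have hδL : ∀ j, algebraMap K L (δ j) ≠ 0 := fun j => by simpa using hδ0 j
  have ha₀0 : aeval (0 : L) a₀ = 1 := by
    simp only [a₀, map_add, map_sub, map_sum, map_mul, map_pow, map_one, ha0, hb0]
    simp
  have ha₀γ : ∀ k, aeval (algebraMap K L (γ k)) a₀ = 0 := fun k => by
    simp only [a₀, map_add, map_sub, map_sum, map_mul, map_pow, map_one, haγ, hbγ]
    simp
  have ha₀β1 : ∀ j, aeval (algebraMap K L (α j) + β j) a₀ = 0 := fun j => by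
    simp only [a₀, map_add, map_sub, map_sum, map_mul, map_pow, map_one, haβ1, hbβ1, aeval_C]
    simp [ite_pow, hδ, hδ0]
  have ha₀β2 : ∀ j, aeval (algebraMap K L (α j) - β j) a₀ = 0 := fun j => by
    simp only [a₀, map_add, map_sub, map_sum, map_mul, map_pow, map_one, haβ2, hbβ2, aeval_C]
    simp [ite_pow, hδ, hδ0]
  -- With `0 ^ 0 = 1`, the `a₀` term contributes only for `m = 0`. On a pair, `b j ^ 2` is `δ j` and
  -- `b j` is `± β j`, which reproduces `evenPart ± oddPart * β j`.
  have hpow : ∀ m, M ^ m = (0 : K) ^ m • aeval M a₀ + ∑ k, γ k ^ m • aeval M (a k) +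
      ∑ j, ((evenPart (α j) (δ j) m / δ j) • aeval M (b j) ^ 2 +
        oddPart (α j) (δ j) m • aeval M (b j)) := fun m => by
    have := heq (X ^ m) ((0 : K) ^ m • a₀ + ∑ k, γ k ^ m • a k +
      ∑ j, ((evenPart (α j) (δ j) m / δ j) • b j ^ 2 + oddPart (α j) (δ j) m • b j))
      ?_ ?_ ?_ ?_
    · simpa only [map_add, map_sum, map_smul, map_pow, aeval_X] using this
    · simp only [map_add, map_sum, map_smul, map_pow, aeval_X, ha0, hb0, ha₀0]
      simp [Algebra.smul_def]
    · intro k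
      simp only [map_add, map_sum, map_smul, map_pow, aeval_X, haγ, hbγ, ha₀γ]
      simp [Algebra.smul_def]
    · intro j
      simp only [map_add, map_sum, map_smul, map_pow, aeval_X, haβ1, hbβ1, ha₀β1]
      simp only [Algebra.smul_def, add_pow_eq_evenPart_add_oddPart, hδ, map_evenPart, map_oddPart, map_div₀]
      simp [ite_pow, hδ, hδL, Finset.sum_add_distrib]
    · intro j
      simp only [map_add, map_sum, map_smul, map_pow, aeval_X, haβ2, hbβ2, ha₀β2]
      simp only [Algebra.smul_def, add_pow_eq_evenPart_add_oddPart, sub_eq_add_neg, neg_sq, hδ, map_evenPart, map_oddPart,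
        map_div₀]
      simp [ite_pow, hδ, hδL, Finset.sum_add_distrib]
  -- The decomposition of `M` is the case `m = 1`, where the even part is `α j` and the odd part is
  -- `1`.
  have hsum : M = ∑ i, γ i • aeval M (a i) - ∑ j, (α j / -δ j) • aeval M (b j) ^ 2 +
      ∑ j, aeval M (b j) := by
    have := hpow 1
    simpa [evenPart, oddPart, Finset.sum_add_distrib, div_neg, add_assoc] using this
  have hbasis : ∀ x ∈ S, ∀ y ∈ S,
      eval x (Lagrange.basis (M.map (algebraMap K L)).finite_spectrum.toFinset id y) =
        if x = y then 1 else 0 := fun x hx y hy => by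
    split_ifs with h
    · subst h
      exact Lagrange.eval_basis_self (v := id) (Set.injOn_id _) (by simpa using hx)
    · exact Lagrange.eval_basis_of_ne (v := id) (Ne.symm h) (by simpa using hx)
  have hcov : ∀ y, frobeniusCovariant (M.map (algebraMap K L)) y = aeval (M.map (algebraMap K L))
      (Lagrange.basis (M.map (algebraMap K L)).finite_spectrum.toFinset id y) := fun y => by
    unfold frobeniusCovariant
    congr!
  have hpm : ∀ j, algebraMap K L (α j) + β j ≠ algebraMap K L (α j) - β j := fun j h => by
    have : (2 : L) * β j = 0 := by linear_combination h
    exact mul_ne_zero h2L (hβ0 j) this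
  have hKp : ∀ j z, algebraMap K L (α j) + β j ≠ algebraMap K L z := fun j z hz =>
    hβK j ⟨z - α j, by rw [map_sub, ← hz]; ring⟩
  have hKm : ∀ j z, algebraMap K L (α j) - β j ≠ algebraMap K L z := fun j z hz =>
    hβK j ⟨α j - z, by rw [map_sub, ← hz]; ring⟩
  have haS : ∀ k, ∀ x ∈ S, aeval x (a k) = if x = algebraMap K L (γ k) then 1 else 0 :=
    fun k x hx => by
      rcases hS x hx with rfl | ⟨i, rfl⟩ | ⟨j, rfl | rfl⟩
      · rw [ha0, if_neg fun h => (hγS k).1 (by simpa using h.symm)]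
      · rw [haγ]
        simp [hlist.γ_injective.eq_iff]
      · rw [haβ1, if_neg (hKp _ _)]
      · rw [haβ2, if_neg (hKm _ _)]
  have hbS : ∀ j, ∀ x ∈ S, aeval x (b j) =
      β j * ((if x = algebraMap K L (α j) + β j then 1 else 0) -
        if x = algebraMap K L (α j) - β j then 1 else 0) :=
    fun j x hx => by
      rcases hS x hx with rfl | ⟨i, rfl⟩ | ⟨l, rfl | rfl⟩
      · rw [hb0, ← map_zero (algebraMap K L), if_neg (hKp _ _).symm, if_neg (hKm _ _).symm]
        simp
      · rw [hbγ, if_neg (hKp _ _).symm, if_neg (hKm _ _).symm]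
        simp
      · rw [hbβ1]
        by_cases h : l = j
        · subst h
          simp [hpm]
        · rw [if_neg h, if_neg (hne l j h).1, if_neg (hne l j h).2]
          simp
      · rw [hbβ2]
        by_cases h : l = j
        · subst h
          simp [(hpm _).symm]
        · rw [if_neg h, if_neg (hne j l (Ne.symm h)).2.symm, if_neg (hne' l j h)]
          simp
  have hlamS' : ∀ j, algebraMap K L (α j) + β j ∈ S := fun j => by
    rw [← hlam]; exact (hlamS j).2
  have hA : ∀ k, (aeval M (a k)).map (algebraMap K L) =
      frobeniusCovariant (M.map (algebraMap K L)) (algebraMap K L (γ k)) := fun k => by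
    rw [hcov]
    exact map_aeval_eq_aeval_of_eq_on_spectrum φ hss fun x hx => by
      rw [haS k x hx, hbasis x hx _ (hγS k).2]
  have hB : ∀ j, (aeval M (b j)).map (algebraMap K L) = β j •
      (frobeniusCovariant (M.map (algebraMap K L)) (algebraMap K L (α j) + β j) -
        frobeniusCovariant (M.map (algebraMap K L)) (algebraMap K L (α j) - β j)) := fun j => by
    rw [hcov, hcov, ← map_sub, ← map_smul]
    exact map_aeval_eq_aeval_of_eq_on_spectrum φ hss fun x hx => by
      rw [hbS j x hx, eval_smul, eval_sub, hbasis x hx _ (hlamS' j), hbasis x hx _ (hbarS j),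
        smul_eq_mul]
  -- `B j ^ 2 / δ j` projects onto the sum of the two conjugate eigenspaces. So the sum of the two
  -- covariants has entries in `K`, as does `β j` times their difference by `hB`.
  have hE : ∀ j, (aeval M (C (δ j)⁻¹ * b j ^ 2)).map (algebraMap K L) =
      frobeniusCovariant (M.map (algebraMap K L)) (algebraMap K L (α j) + β j) +
        frobeniusCovariant (M.map (algebraMap K L)) (algebraMap K L (α j) - β j) := fun j => by
    rw [hcov, hcov, ← map_add]
    exact map_aeval_eq_aeval_of_eq_on_spectrum φ hss fun x hx => by
      rw [map_mul, map_pow, aeval_C, hbS j x hx, eval_add, hbasis x hx _ (hlamS' j),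
        hbasis x hx _ (hbarS j), mul_pow, hδ, map_inv₀, inv_mul_cancel_left₀ (hδL j)]
      by_cases h : x = algebraMap K L (α j) + β j
      · rw [if_pos h, if_neg (h ▸ hpm j)]; ring
      · rw [if_neg h]; split_ifs <;> ring
  -- For corresponding entries `c`, `c'` of the two covariants, `u = c + c'` and `v = β j * (c -
  -- c')` are in `K`. Hence `c` and `c'` are `u / 2 ± (v / (2 * δ j)) * β j`, and `involution_add`
  -- exchanges them.
  have hconj : ∀ j,
      (frobeniusCovariant (M.map (algebraMap K L)) (algebraMap K L (α j) + β j)).map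
        (involution K) =
      frobeniusCovariant (M.map (algebraMap K L)) (algebraMap K L (α j) - β j) := fun j => by
    ext p q
    have h1 := congrFun (congrFun (hB j) p) q
    have h3 := congrFun (congrFun (hE j) p) q
    simp only [Matrix.map_apply, Matrix.smul_apply, Matrix.sub_apply, Matrix.add_apply,
      smul_eq_mul] at h1 h3 ⊢
    generalize frobeniusCovariant (M.map (algebraMap K L)) (algebraMap K L (α j) + β j) p q = c
      at h1 h3 ⊢
    generalize frobeniusCovariant (M.map (algebraMap K L)) (algebraMap K L (α j) - β j) p q = c'
      at h1 h3 ⊢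
    generalize aeval M (C (δ j)⁻¹ * b j ^ 2) p q = u at h3
    generalize aeval M (b j) p q = v at h1
    have hv : algebraMap K L (v / (2 * δ j)) * β j = (c - c') / 2 := by
      rw [map_div₀, h1, map_mul, ← hδ, map_ofNat]
      have := hβ0 j
      field_simp
    have hu : algebraMap K L (u / 2) = (c + c') / 2 := by
      rw [map_div₀, h3, map_ofNat]
    have hc : c = algebraMap K L (u / 2) + algebraMap K L (v / (2 * δ j)) * β j := by
      rw [hu, hv]; field_simp; ring
    have hc' : c' = algebraMap K L (u / 2) - algebraMap K L (v / (2 * δ j)) * β j := by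
      rw [hu, hv]; field_simp; ring
    rw [hc', hc, involution_add h2 (hδ j) (hβK j)]
  refine ⟨fun k => aeval M (a k), fun j => aeval M (b j), fun j => -δ j, aeval M a₀, hA,
    fun j => ?_, fun j => ?_, ?_, ?_, fun j => neg_ne_zero.2 (hδ0 j), fun m => ?_⟩
  · have h := hB j
    rw [← hconj, ← hlam] at h
    exact h
  · rw [map_neg, ← hδ]
  · constructor
    · exact hsum
    · by_contra h
      obtain ⟨rfl, rfl⟩ : s = 0 ∧ t = 0 := by omega
      exact hM (by simpa using hsum)
    -- If the matrix were zero, its polynomial would vanish at every eigenvalue, yet its value at `γ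
    -- k` is `1`.
    · intro k h
      have := aeval_eq_zero_of_mem_spectrum (hγS k).2 h
      rw [haγ, if_pos rfl] at this
      exact one_ne_zero this
    · intro j h
      have := aeval_eq_zero_of_mem_spectrum (hlamS' j) h
      rw [hbβ1, if_pos rfl] at this
      exact hβ0 j this
    · rintro j ⟨r, hr⟩
      rw [neg_neg] at hr
      have h1 := hδ j
      rw [hr, map_mul] at h1
      rcases sq_eq_sq_iff_eq_or_eq_neg.1 (h1.trans (sq _).symm) with h | h
      · exact hβK j ⟨r, h.symm⟩
      · exact hβK j ⟨-r, by rw [map_neg, h]⟩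
    · exact fun k => (hγS k).1
    · exact hlist.γ_injective
    -- Under `φ` the square roots `x` and `y` become `± β j` and `± β l`, so in each of the four
    -- sign cases two distinct listed eigenvalues would coincide.
    · intro j l hjl x y hx hy hxy
      have key : ∀ (i : Fin t) (z : AlgebraicClosure K),
          z ^ 2 = -algebraMap K (AlgebraicClosure K) (-δ i) → φ z = β i ∨ φ z = -β i := by
        intro i z hz
        have := congrArg φ hz
        rw [map_pow, map_neg, φ.commutes, map_neg, neg_neg, ← hδ] at this
        exact sq_eq_sq_iff_eq_or_eq_neg.1 this
      have h := congrArg φ hxy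
      rw [map_add, map_add, φ.commutes, φ.commutes] at h
      rcases key j x hx with h1 | h1 <;> rcases key l y hy with h3 | h3 <;>
        rw [h1, h3] at h
      · exact (hne j l hjl).1 h
      · exact (hne j l hjl).2 (h.trans (sub_eq_add_neg _ _).symm)
      · exact (hne l j hjl.symm).2 (h.symm.trans (sub_eq_add_neg _ _).symm)
      · exact hne' j l hjl (by rw [sub_eq_add_neg, sub_eq_add_neg]; exact h)
    · intro k
      rw [← map_mul]
      refine heq _ _ ?_ ?_ ?_ ?_ <;> simp only [map_mul, ha0, haγ, haβ1, haβ2] <;> simp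
    · intro i k hik
      rw [← map_mul, ← map_zero (aeval (R := K) M)]
      refine heq _ _ ?_ ?_ ?_ ?_ <;> simp only [map_mul, ha0, haγ, haβ1, haβ2, map_zero]
      · simp
      · intro l
        by_cases h : l = i
        · subst h; simp [hik]
        · simp [h]
      · simp
      · simp
    · intro k j
      rw [← map_mul, ← map_zero (aeval (R := K) M)]
      refine heq _ _ ?_ ?_ ?_ ?_ <;>
        simp only [map_mul, ha0, haβ1, haβ2, hb0, hbγ, map_zero, mul_zero, zero_mul, implies_true]
    · intro k j
      rw [← map_mul, ← map_zero (aeval (R := K) M)]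
      refine heq _ _ ?_ ?_ ?_ ?_ <;>
        simp only [map_mul, ha0, haβ1, haβ2, hb0, hbγ, map_zero, mul_zero, zero_mul, implies_true]
    · intro j l hjl
      rw [← map_mul, ← map_zero (aeval (R := K) M)]
      refine heq _ _ ?_ ?_ ?_ ?_ <;>
        simp only [map_mul, hb0, hbγ, hbβ1, hbβ2, map_zero, mul_zero, implies_true] <;>
      · intro i
        by_cases h : i = j
        · subst h; simp [hjl]
        · simp [h]
    · intro j
      rw [neg_smul, neg_neg, ← map_pow, ← map_smul]
      refine heq _ _ ?_ ?_ ?_ ?_ <;>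
        simp only [map_smul, map_pow, hb0, hbγ, hbβ1, hbβ2]
      · simp
      · simp
      all_goals
        intro i
        rw [Algebra.smul_def, ← hδ]
        split_ifs <;> ring
  · simp only [a₀, map_add, map_sub, map_sum, map_mul, map_pow, map_one, aeval_C,
      ← Algebra.smul_def]
  · simpa only [neg_neg] using hpow m

end FineFrobenius

/-! ### Convergence of the coefficient series in `K^c`. -/

section Convergence

variable {K : Type*} [NormedField K]

theorem algebraMap_KcBarC_eq (x : K) :
    algebraMap K (KcBarC K) x = ((algebraMap K (KcBar K) x : KcBar K) : KcBarC K) := rfl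

theorem algebraMap_Kc_KcBarC_algebraMap (x : K) :
    algebraMap (Kc K) (KcBarC K) (algebraMap K (Kc K) x) = algebraMap K (KcBarC K) x := by
  rw [algebraMap_KcBarC_eq, IsScalarTower.algebraMap_apply K (Kc K) (KcBar K)]
  rfl

theorem norm_algebraMap_Kc (x : K) : ‖algebraMap K (Kc K) x‖ = ‖x‖ :=
  UniformSpace.Completion.norm_coe x

theorem continuous_algebraMap_KcBarC : Continuous (algebraMap (Kc K) (KcBarC K)) :=
  continuous_algebraMap _ _

/-- A series in `K` that is absolutely summable sums in `K^c`, compatibly with its image. -/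
theorem hasSum_algebraMap {g : ℕ → K} (hg : Summable fun m => ‖g m‖) :
    HasSum (fun m => algebraMap K (Kc K) (g m)) (∑' m, algebraMap K (Kc K) (g m)) ∧
    HasSum (fun m => algebraMap K (KcBarC K) (g m))
      (algebraMap (Kc K) (KcBarC K) (∑' m, algebraMap K (Kc K) (g m))) := by
  have h : Summable fun m => algebraMap K (Kc K) (g m) :=
    Summable.of_norm (by simpa only [norm_algebraMap_Kc] using hg)
  refine ⟨h.hasSum, ?_⟩
  have := h.hasSum.map (algebraMap (Kc K) (KcBarC K)) continuous_algebraMap_KcBarC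
  simpa only [Function.comp_def, algebraMap_Kc_KcBarC_algebraMap] using this

variable {f : PowerSeries K} {x : KcBar K} {δ : K}

theorem summable_norm_evenPart
    (h1 : ¬ IsNonarchimedean (norm : K → ℝ) →
      ‖horizontal K x‖ₑ + ‖vertical K x‖ₑ < convRadius f)
    (h2 : IsNonarchimedean (norm : K → ℝ) →
      max ‖horizontal K x‖ₑ ‖vertical K x‖ₑ < convRadius f)
    (hδ : vertical K x ^ 2 = algebraMap K (KcBar K) δ) :
    Summable fun m => ‖PowerSeries.coeff m f * evenPart (horizontal K x) δ m‖ := by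
  obtain ⟨r, hr, h⟩ := exists_summable_bound f x h1 h2
  refine hr.of_nonneg_of_le (fun m => norm_nonneg _) fun m => ?_
  rw [norm_mul, ← norm_algebraMap_KcBar (evenPart _ _ _), map_evenPart, ← hδ]
  exact mul_le_mul_of_nonneg_left (h m).1 (norm_nonneg _)

/-- The available bound concerns `oddPart` times the vertical component; division by the norm of
that component gives the claim, which is why it must be nonzero. -/
theorem summable_norm_oddPart
    (h1 : ¬ IsNonarchimedean (norm : K → ℝ) →
      ‖horizontal K x‖ₑ + ‖vertical K x‖ₑ < convRadius f)
    (h2 : IsNonarchimedean (norm : K → ℝ) →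
      max ‖horizontal K x‖ₑ ‖vertical K x‖ₑ < convRadius f)
    (hδ : vertical K x ^ 2 = algebraMap K (KcBar K) δ) (hx : vertical K x ≠ 0) :
    Summable fun m => ‖PowerSeries.coeff m f * oddPart (horizontal K x) δ m‖ := by
  obtain ⟨r, hr, h⟩ := exists_summable_bound f x h1 h2
  refine (hr.mul_right ‖vertical K x‖⁻¹).of_nonneg_of_le (fun m => norm_nonneg _) fun m => ?_
  rw [norm_mul, ← norm_algebraMap_KcBar (oddPart _ _ _), map_oddPart, ← hδ, mul_assoc]
  refine mul_le_mul_of_nonneg_left ?_ (norm_nonneg _)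
  rw [le_mul_inv_iff₀ (norm_pos_iff.2 hx), ← norm_mul]
  exact (h m).2

theorem hasSum_realTerm (hδ : vertical K x ^ 2 = algebraMap K (KcBar K) δ)
    (hs : Summable fun m => ‖PowerSeries.coeff m f * evenPart (horizontal K x) δ m‖) :
    HasSum (fun m : ℕ => (realTerm f x m : KcBarC K)) (algebraMap (Kc K) (KcBarC K)
      (∑' m, algebraMap K (Kc K) (PowerSeries.coeff m f * evenPart (horizontal K x) δ m))) := by
  refine (hasSum_algebraMap hs).2.congr_fun fun m => ?_
  rw [algebraMap_KcBarC_eq, realTerm_eq, map_mul, map_evenPart, hδ]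

/-- The constant `-i * vertical K x` factors out of every term and leaves a series with terms in
`K`. -/
theorem hasSum_imagTerm (i : KcBar K) (hδ : vertical K x ^ 2 = algebraMap K (KcBar K) δ)
    (hs : Summable fun m => ‖PowerSeries.coeff m f * oddPart (horizontal K x) δ m‖) :
    HasSum (fun m : ℕ => (imagTerm f i x m : KcBarC K))
      (((-i * vertical K x : KcBar K) : KcBarC K) * algebraMap (Kc K) (KcBarC K)
        (∑' m, algebraMap K (Kc K) (PowerSeries.coeff m f * oddPart (horizontal K x) δ m))) := by
  refine ((hasSum_algebraMap hs).2.mul_left _).congr_fun fun m => ?_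
  rw [algebraMap_KcBarC_eq, imagTerm_eq, map_mul, map_oddPart, hδ, ← UniformSpace.Completion.coe_mul]
  congr 1
  ring

theorem summable_norm_coeff_mul {r : K} (hr : ‖r‖ₑ < convRadius f) :
    Summable fun m => ‖PowerSeries.coeff m f * r ^ m‖ := by
  simpa [norm_mul, norm_pow] using summable_norm_coeff_mul_pow (r := ‖r‖₊) f hr

theorem hasSum_algebraMap_smul_map {n : ℕ} {g : ℕ → K} (hg : Summable fun m => ‖g m‖)
    (A : Matrix (Fin n) (Fin n) K) :
    HasSum (fun m => (g m • A).map (algebraMap K (Kc K)))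
      ((∑' m, algebraMap K (Kc K) (g m)) • A.map (algebraMap K (Kc K))) := by
  refine ((hasSum_algebraMap hg).1.smul_const (A.map (algebraMap K (Kc K)))).congr_fun fun m => ?_
  ext p q
  simp

theorem seriesValue_algebraMap (r : K) : seriesValue f (algebraMap K (Kc K) r) =
    ∑' m, algebraMap K (Kc K) (PowerSeries.coeff m f * r ^ m) := by
  simp only [seriesValue, Algebra.smul_def, map_mul, map_pow]

end Convergence

/-! ### The formula for `f(M)`. -/

theorem mainTheorem4 {K : Type*} [NormedField K] (hchar : ringChar K ≠ 2)
    (f : PowerSeries K) {n : ℕ} (M : Matrix (Fin n) (Fin n) K) (hM : M ≠ 0)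
    (hΩ : M ∈ OmegaHat n f) (hss : IsSemisimpleMatrix M) (hsb : M.splittingBound K ≤ 2)
    (i : KcBar K) (hi : i ^ 2 = -1)
    {s t : ℕ} (γ : Fin s → K) (lam : Fin t → KcBar K) (hlist : IsEigenvalueListing M γ lam) :
    ∃ (A : Fin s → Matrix (Fin n) (Fin n) K) (B : Fin t → Matrix (Fin n) (Fin n) K)
      (ν : Fin t → K) (A₀ : Matrix (Fin n) (Fin n) K),
      -- the fine Frobenius covariants and the fine Frobenius decomposition of `M`
      (∀ k, (A k).map (algebraMap K (KcBar K)) =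
        frobeniusCovariant (M.map (algebraMap K (KcBar K))) (algebraMap K (KcBar K) (γ k))) ∧
      (∀ j, (B j).map (algebraMap K (KcBar K)) = vertical K (lam j) •
        (frobeniusCovariant (M.map (algebraMap K (KcBar K))) (lam j) -
          (frobeniusCovariant (M.map (algebraMap K (KcBar K))) (lam j)).map (involution K))) ∧
      (∀ j, algebraMap K (KcBar K) (ν j) = -vertical K (lam j) ^ 2) ∧
      IsFineFrobeniusDecomposition M γ A (fun j => horizontal K (lam j)) ν B ∧
      A₀ = 1 - ∑ k, A k + ∑ j, (ν j)⁻¹ • B j ^ 2 ∧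
      -- all the series converge
      Summable (fun m : ℕ => PowerSeries.coeff m f • M.map (algebraMap K (Kc K)) ^ m) ∧
      (∀ k, Summable (fun m : ℕ => PowerSeries.coeff m f • algebraMap K (Kc K) (γ k) ^ m)) ∧
      (∀ j, Summable (fun m : ℕ => (realTerm f (lam j) m : KcBarC K))) ∧
      (∀ j, Summable (fun m : ℕ => (imagTerm f i (lam j) m : KcBarC K))) ∧
      -- the coefficients lie in the completion of `K`
      (∀ j, realSeries f (lam j) / ((vertical K (lam j) : KcBar K) : KcBarC K) ^ 2 ∈
        Set.range (algebraMap (Kc K) (KcBarC K))) ∧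
      (∀ j, (i : KcBarC K) * (imagSeries f i (lam j) / ((vertical K (lam j) : KcBar K) : KcBarC K)) ∈
        Set.range (algebraMap (Kc K) (KcBarC K))) ∧
      -- the formula for `f(M)`
      (seriesValue f (M.map (algebraMap K (Kc K)))).map (algebraMap (Kc K) (KcBarC K)) =
        algebraMap (Kc K) (KcBarC K) (seriesValue f (0 : Kc K)) •
            A₀.map (algebraMap K (KcBarC K)) +
          ∑ k, algebraMap (Kc K) (KcBarC K) (seriesValue f (algebraMap K (Kc K) (γ k))) •
            (A k).map (algebraMap K (KcBarC K)) +
          ∑ j, ((realSeries f (lam j) / ((vertical K (lam j) : KcBar K) : KcBarC K) ^ 2) •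
              (B j).map (algebraMap K (KcBarC K)) ^ 2 +
            ((i : KcBarC K) * (imagSeries f i (lam j) / ((vertical K (lam j) : KcBar K) : KcBarC K))) •
              (B j).map (algebraMap K (KcBarC K))) := by
  have h2 : (2 : K) ≠ 0 := Ring.two_ne_zero hchar
  obtain ⟨hrad, hreg⟩ := hΩ
  let φ : AlgebraicClosure K →ₐ[K] KcBar K := IsAlgClosed.lift
  obtain ⟨A, B, ν, A₀, hA, hB, hν, hfine, hA₀, hν0, hpow⟩ :=
    exists_fineFrobeniusDecomposition h2 φ hM hss hsb
      (fun x hx => (hreg x hx).1.1.isIntegral) hlist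
  have hlamS : ∀ j, lam j ∈ spectrum (KcBar K) (M.map (algebraMap K (KcBar K))) := fun j => by
    have : lam j ∈ Set.range (Sum.elim lam fun j => involution K (lam j)) := ⟨Sum.inl j, rfl⟩
    rw [hlist.range_lam] at this
    exact this.2
  -- Each `γ k` is an eigenvalue, so its norm is at most the spectral radius.
  have hγS : ∀ k, ‖γ k‖ₑ < convRadius f := fun k => by
    have : γ k ∈ Set.range γ := ⟨k, rfl⟩
    rw [hlist.range_γ] at this
    refine lt_of_le_of_lt ?_ hrad
    have hk : ‖γ k‖ₑ = (‖algebraMap K (KcBar K) (γ k)‖₊ : ENNReal) := by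
      rw [enorm_eq_nnnorm]
      congr 1
      exact Subtype.ext (norm_algebraMap_KcBar (γ k)).symm
    rw [hk]
    exact le_iSup₂_of_le (f := fun x (_ : x ∈ spectrum (KcBar K)
      (M.map (algebraMap K (KcBar K)))) => (‖x‖₊ : ENNReal)) _ this.2 le_rfl
  have h0 : ‖(0 : K)‖ₑ < convRadius f := by
    rw [enorm_zero]
    exact lt_of_le_of_lt zero_le hrad
  have hδ : ∀ j, vertical K (lam j) ^ 2 = algebraMap K (KcBar K) (-ν j) := fun j => by
    rw [map_neg, hν, neg_neg]
  have hv0 : ∀ j, vertical K (lam j) ≠ 0 := fun j h => hν0 j (by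
    have := hν j
    rw [h] at this
    simpa using this)
  have hve : ∀ j, ((vertical K (lam j) : KcBar K) : KcBarC K) ≠ 0 := fun j h =>
    hv0 j (UniformSpace.Completion.coe_injective _ (by
      rw [h, UniformSpace.Completion.coe_zero]))
  have hvsq : ∀ j, ((vertical K (lam j) : KcBar K) : KcBarC K) ^ 2 =
      algebraMap (Kc K) (KcBarC K) (algebraMap K (Kc K) (-ν j)) := fun j => by
    rw [algebraMap_Kc_KcBarC_algebraMap, algebraMap_KcBarC_eq, ← hδ, sq, sq,
      UniformSpace.Completion.coe_mul]
  have hE := fun j => summable_norm_evenPart (f := f) (hreg _ (hlamS j)).2.1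
    (hreg _ (hlamS j)).2.2 (hδ j)
  have hO := fun j => summable_norm_oddPart (f := f) (hreg _ (hlamS j)).2.1
    (hreg _ (hlamS j)).2.2 (hδ j) (hv0 j)
  have hR := fun j => hasSum_realTerm (hδ j) (hE j)
  have hI := fun j => hasSum_imagTerm i (hδ j) (hO j)
  have hRv : ∀ j, realSeries f (lam j) / ((vertical K (lam j) : KcBar K) : KcBarC K) ^ 2 =
      algebraMap (Kc K) (KcBarC K) (∑' m, algebraMap K (Kc K)
        (PowerSeries.coeff m f * (evenPart (horizontal K (lam j)) (-ν j) m / -ν j))) := fun j => by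
    rw [realSeries, (hR j).tsum_eq, hvsq, ← map_div₀, ← tsum_div_const]
    simp only [← map_div₀, mul_div_assoc]
  -- The product `i * (-i) = 1` removes the chosen square root, and the vertical component cancels,
  -- leaving the odd coefficient series.
  have hIv : ∀ j, (i : KcBarC K) *
      (imagSeries f i (lam j) / ((vertical K (lam j) : KcBar K) : KcBarC K)) =
      algebraMap (Kc K) (KcBarC K) (∑' m, algebraMap K (Kc K)
        (PowerSeries.coeff m f * oddPart (horizontal K (lam j)) (-ν j) m)) := fun j => by
    have hii : (i : KcBarC K) * (i : KcBarC K) = -1 := by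
      rw [← UniformSpace.Completion.coe_mul, ← sq, hi, UniformSpace.Completion.coe_neg,
        UniformSpace.Completion.coe_one]
    rw [imagSeries, (hI j).tsum_eq, UniformSpace.Completion.coe_mul,
      UniformSpace.Completion.coe_neg]
    have := hve j
    field_simp
    linear_combination (-(algebraMap (Kc K) (KcBarC K) (∑' m, algebraMap K (Kc K)
        (PowerSeries.coeff m f * oddPart (horizontal K (lam j)) (-ν j) m)))) * hii
  have hE' : ∀ j, Summable fun m =>
      ‖PowerSeries.coeff m f * (evenPart (horizontal K (lam j)) (-ν j) m / -ν j)‖ := fun j => by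
    simpa only [← mul_div_assoc, norm_div] using (hE j).div_const ‖-ν j‖
  -- The formula for `M ^ m`, weighted by the `m`-th coefficient of `f`, is summed term by term over
  -- `K^c`; `f(0)` is treated as the value at the eigenvalue `γ = 0`.
  have hsum : HasSum (fun m : ℕ => PowerSeries.coeff m f • M.map (algebraMap K (Kc K)) ^ m)
      (seriesValue f (0 : Kc K) • A₀.map (algebraMap K (Kc K)) +
        ∑ k, seriesValue f (algebraMap K (Kc K) (γ k)) • (A k).map (algebraMap K (Kc K)) +
        ∑ j, ((∑' m, algebraMap K (Kc K)
          (PowerSeries.coeff m f * (evenPart (horizontal K (lam j)) (-ν j) m / -ν j))) •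
            (B j ^ 2).map (algebraMap K (Kc K)) +
          (∑' m, algebraMap K (Kc K)
            (PowerSeries.coeff m f * oddPart (horizontal K (lam j)) (-ν j) m)) •
            (B j).map (algebraMap K (Kc K)))) := by
    have hz : seriesValue f (0 : Kc K) = seriesValue f (algebraMap K (Kc K) 0) := by
      rw [map_zero]
    rw [hz]
    simp only [seriesValue_algebraMap]
    refine (((hasSum_algebraMap_smul_map (summable_norm_coeff_mul h0) A₀).add
      (hasSum_sum fun k _ => hasSum_algebraMap_smul_map (summable_norm_coeff_mul (hγS k)) (A k))).add
      (hasSum_sum fun j _ => (hasSum_algebraMap_smul_map (hE' j) (B j ^ 2)).add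
        (hasSum_algebraMap_smul_map (hO j) (B j)))).congr_fun fun m => ?_
    have hMm : PowerSeries.coeff m f • M.map (algebraMap K (Kc K)) ^ m =
        (PowerSeries.coeff m f • M ^ m).map (algebraMap K (Kc K)) := by
      have : (M ^ m).map (algebraMap K (Kc K)) = M.map (algebraMap K (Kc K)) ^ m :=
        map_pow (algebraMap K (Kc K)).mapMatrix M m
      rw [← this]
      ext p q
      rw [Matrix.smul_apply, Matrix.map_apply, Matrix.map_apply, Matrix.smul_apply, smul_eq_mul,
        map_mul, Algebra.smul_def]
    rw [hMm, hpow m]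
    have hadd : ∀ X Y : Matrix (Fin n) (Fin n) K, (X + Y).map (algebraMap K (Kc K)) =
        X.map (algebraMap K (Kc K)) + Y.map (algebraMap K (Kc K)) :=
      map_add (algebraMap K (Kc K)).mapMatrix
    have hsm : ∀ {ι : Type} (u : Finset ι) (X : ι → Matrix (Fin n) (Fin n) K),
        (∑ l ∈ u, X l).map (algebraMap K (Kc K)) = ∑ l ∈ u, (X l).map (algebraMap K (Kc K)) :=
      fun u X => map_sum (algebraMap K (Kc K)).mapMatrix X u
    simp only [smul_add, Finset.smul_sum, smul_smul, hadd, hsm]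
  refine ⟨A, B, ν, A₀, hA, hB, hν, hfine, hA₀, hsum.summable, fun k => ?_, fun j => (hR j).summable,
    fun j => (hI j).summable, fun j => ⟨_, (hRv j).symm⟩, fun j => ⟨_, (hIv j).symm⟩, ?_⟩
  · simpa only [Algebra.smul_def, map_mul, map_pow] using
      (hasSum_algebraMap (summable_norm_coeff_mul (hγS k))).1.summable
  · have hfM := hsum.tsum_eq
    change seriesValue f _ = _ at hfM
    rw [hfM]
    have hcomp : ∀ (X : Matrix (Fin n) (Fin n) K) (c : Kc K),
        (algebraMap (Kc K) (KcBarC K)).mapMatrix (c • X.map (algebraMap K (Kc K))) =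
          algebraMap (Kc K) (KcBarC K) c • X.map (algebraMap K (KcBarC K)) := fun X c => by
      ext p q
      simp [algebraMap_Kc_KcBarC_algebraMap]
    have hsq : ∀ j, (B j ^ 2).map (algebraMap K (KcBarC K)) =
        (B j).map (algebraMap K (KcBarC K)) ^ 2 := fun j =>
      map_pow (algebraMap K (KcBarC K)).mapMatrix (B j) 2
    simp only [hRv, hIv, ← hsq, ← hcomp, ← map_add, ← map_sum]
    rfl
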